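/- Theorem 2.1. Conventions: graphs are non-empty, simple, connected and locally finite, and $d$ denotes the graph distance. For a graph $\mathcal{G}$ and $p\in[0,1]$, Bernoulli bond percolation keeps each edge of $\mathcal{G}$ independently with probability $p$ (and erases it otherwise); clusters are the connected components of the resulting random graph on $V(\mathcal{G})$, and $$p_c(\mathcal{G}):=\sup\{p\in[0,1] : \text{almost surely there is no infinite cluster}\}.$$ A subtree of a graph is a (finite or infinite) subgraph that is a tree. For a map $\pi:V(\mathcal{G})\to V(\mathcal{H})$ between the vertex sets of two graphs: - $\pi$ is a *weak covering map* if $d(\pi(x),\pi(y))\le d(x,y)$ for all $x,y\in V(\mathcal{G})$, and for every $x\in V(\mathcal{G})$ and every neighbour $u$ of $\pi(x)$ in $\mathcal{H}$ there is a neighbour $y$ of $x$ in $\mathcal{G}$ with $\pi(y)=u$; - $\pi$ *has tame fibres* if there is some $R$ such that for every $x\in V(\mathcal{G})$ there is some $y\in V(\mathcal{G})$ with $\pi(x)=\pi(y)$ and $0<d(x,y)\le R$; - a *lift* of a subtree $\mathcal{T}$ of $\mathcal{H}$ is a subtree $\mathcal{T}'$ of $\mathcal{G}$ such that $\pi$ induces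 a graph isomorphism from $\mathcal{T}'$ to $\mathcal{T}$; - $\pi$ has the *disjoint tree-lifting property* if for every subtree $\mathcal{T}$ of $\mathcal{H}$ and all distinct $x,y\in V(\mathcal{G})$ with $\pi(x)=\pi(y)\in V(\mathcal{T})$, there are two vertex-disjoint lifts of $\mathcal{T}$, one containing $x$ and the other containing $y$. Let $\mathcal{G}$ and $\mathcal{H}$ be graphs of bounded degree (the degrees of the vertices of each graph are bounded). Assume that there is a weak covering map $\pi:V(\mathcal{G})\to V(\mathcal{H})$ with tame fibres and the disjoint tree-lifting property. If $p_c(\mathcal{G})<1$, then $p_c(\mathcal{G})<p_c(\mathcal{H})$. -/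

import Mathlib

open scoped unitInterval

namespace PercolationCovering

/-! ### Bernoulli bond percolation -/

section Percolation

variable {V : Type*}

/-- The graph on `V` obtained from `G` by keeping exactly those edges of `G` that belong to `S`
(the open edges); all vertices are kept. -/
def openSubgraph (G : SimpleGraph V) (S : Set (Sym2 V)) : SimpleGraph V :=
  SimpleGraph.fromEdgeSet (S ∩ G.edgeSet)

/-- The cluster of `x`: the vertices joined to `x` by a path of open edges. -/
def cluster (G : SimpleGraph V) (S : Set (Sym2 V)) (x : V) : Set V :=
  {y | (openSubgraph G S).Reachable x y}

/-- The configuration `S` has at least one infinite cluster. -/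
def HasInfiniteCluster (G : SimpleGraph V) (S : Set (Sym2 V)) : Prop :=
  ∃ x, (cluster G S x).Infinite

/-- Bernoulli bond percolation on `G`: the law of the random set of open edges when each edge of
`G` is open with probability `p`, independently of the others. -/
noncomputable def bondPercolation (G : SimpleGraph V) (p : I) : MeasureTheory.Measure (Set (Sym2 V)) :=
  ProbabilityTheory.setBernoulli G.edgeSet p

/-- The critical parameter `p_c(G) = sup {p ∈ [0,1] : a.s. there is no infinite cluster}`, as an
element of `[0,1]`. The set contains `0`; for a finite graph the value is `1`. -/
noncomputable def criticalParameter (G : SimpleGraph V) : I :=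
  sSup {p : I | ∀ᵐ S ∂(bondPercolation G p), ¬ HasInfiniteCluster G S}

/-- There is a uniform finite bound on the number of neighbours of the vertices. -/
def BoundedDegree (G : SimpleGraph V) : Prop :=
  ∃ D : ℕ, ∀ x, (G.neighborSet x).encard ≤ D

end Percolation

/-! ### Covering maps -/

section Covering

variable {V W : Type*}

/-- A weak covering map: `1`-Lipschitz for the graph distances (so that an edge may be collapsed
to a vertex), with the weak lifting property for edges. -/
structure IsWeakCovering (G : SimpleGraph V) (H : SimpleGraph W) (π : V → W) : Prop where
  dist_le : ∀ x y, H.dist (π x) (π y) ≤ G.dist x y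
  exists_lift : ∀ x u, H.Adj (π x) u → ∃ y, G.Adj x y ∧ π y = u

/-- Tame fibres: within bounded distance of every vertex there is another vertex of its fibre. -/
def HasTameFibres (G : SimpleGraph V) (π : V → W) : Prop :=
  ∃ R : ℕ, ∀ x, ∃ y, π x = π y ∧ 0 < G.dist x y ∧ G.dist x y ≤ R

/-- `T'` is a lift of the subtree `T` of `H`: it is a subtree of `G` such that `π` induces a graph
isomorphism from `T'` to `T`. -/
def IsLift {G : SimpleGraph V} {H : SimpleGraph W} (π : V → W) (T' : G.Subgraph)
    (T : H.Subgraph) : Prop :=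
  T'.coe.IsTree ∧ ∃ φ : T'.coe ≃g T.coe, ∀ x : T'.verts, (φ x : W) = π x

/-- The disjoint tree-lifting property. The subtree `T` may be finite or infinite. -/
def HasDisjointTreeLifting (G : SimpleGraph V) (H : SimpleGraph W) (π : V → W) : Prop :=
  ∀ T : H.Subgraph, T.coe.IsTree → ∀ x y : V, x ≠ y → π x = π y → π x ∈ T.verts →
    ∃ T₁ T₂ : G.Subgraph, IsLift π T₁ T ∧ IsLift π T₂ T ∧
      x ∈ T₁.verts ∧ y ∈ T₂.verts ∧ Disjoint T₁.verts T₂.verts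

end Covering

end PercolationCovering

open PercolationCovering

/-! The proof compares percolation on `H` with an enhanced percolation on `H`, and the latter with
percolation on `G`. A maximal separated net splits `H` into connected cells of bounded radius, each
containing the ball of radius `R` about its centre, where `R` is the tameness constant. Besides the
edges, each centre carries an independent activity bit of density `s`: if a cell is entirely
reached, its inner edges are all open and its centre is active, then every neighbour of the cell is
reached too (`EnhReach`).

The enhancement strictly helps, by the Aizenman–Grimmett argument. If an edge touching a cell is
pivotal, changing boundedly many bits at that cell makes its activity pivotal
(`exists_pivotal_activity`). With all densities in `[δ, 1 - δ]` such a change costs a bounded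
factor, so by Russo's formula a small loss in `p` is compensated by a gain in `s`, uniformly over
finite volumes (`enhProb_le_of_trade`).

The cluster in `G` dominates the enhanced cluster as soon as `s ≤ p ^ K` for a suitable constant `K`
(`enhProb_le_clusterHits`). The enhanced cluster is explored step by step and lifted: an edge of `H`
is revealed through one edge of `G` above it. The activity of a fully open cell is simulated by
opening boundedly many further edges of `G`. Tameness gives a second point `y` of the fibre of the
lifted centre `x`, joined to `x` above the cell. For a boundary edge from `a` to `b`, the path from
the centre through `a` to `b` has disjoint lifts from `x` and `y`, so one of them avoids the lift of
`a` already in use. Its last edge is therefore not the one that may already have been found closed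
(`exists_connecting_edges`, `IsExploration.exists_fresh_edges`).

At a parameter slightly above `p_c(H) < 1`, an infinite cluster has positive probability; trading
`p` against `s` moves the parameter below `p_c(H)`, and the domination then makes `G` percolate
there. A path count gives `p_c(H) > 0`, which leaves room below. -/

namespace PercolationCovering

/-! ### Expectations over finitely many independent bits -/

section FiniteBernoulli

open Classical in
/-- The expectation of `f S`, where `S` is the random subset of `F` that contains each `i ∈ F`
independently with probability `q i`. -/
noncomputable def bernoulliExp {ι : Type*} (q : ι → ℝ) (F : Finset ι) (f : Finset ι → ℝ) : ℝ :=
  ∑ S ∈ F.powerset, (∏ i ∈ S, q i) * (∏ i ∈ F \ S, (1 - q i)) * f S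

variable {ι : Type*} {q q' : ι → ℝ} {F F' : Finset ι} {f g : Finset ι → ℝ}

@[simp] theorem bernoulliExp_empty (q : ι → ℝ) (f : Finset ι → ℝ) :
    bernoulliExp q ∅ f = f ∅ := by
  simp [bernoulliExp]

/-- Conditioning on one bit. This recursion drives the inductions on `F` below. -/
theorem bernoulliExp_insert [dec : DecidableEq ι] (q : ι → ℝ) (f : Finset ι → ℝ) {i : ι} (hi : i ∉ F) :
    bernoulliExp q (insert i F) f =
      q i * bernoulliExp q F (fun S => f (insert i S)) + (1 - q i) * bernoulliExp q F f := by
  rw [Subsingleton.elim dec fun a b => Classical.propDecidable (a = b)]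
  clear dec
  let : DecidableEq ι := fun a b => Classical.propDecidable (a = b)
  unfold bernoulliExp
  rw [Finset.sum_powerset_insert hi, add_comm, Finset.mul_sum, Finset.mul_sum]
  congr 1
  · refine Finset.sum_congr rfl fun S hS => ?_
    have hiS : i ∉ S := fun h => hi (Finset.mem_powerset.1 hS h)
    have h1 : insert i F \ insert i S = F \ S := by
      ext j; simp only [Finset.mem_sdiff, Finset.mem_insert]; grind
    rw [h1, Finset.prod_insert hiS]
    ring
  · refine Finset.sum_congr rfl fun S hS => ?_
    have hiS : i ∉ S := fun h => hi (Finset.mem_powerset.1 hS h)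
    have h1 : insert i F \ S = insert i (F \ S) := by
      ext j; simp only [Finset.mem_sdiff, Finset.mem_insert]; grind
    rw [h1, Finset.prod_insert (by simp [hi])]
    ring

theorem bernoulliExp_congr_right (q : ι → ℝ) (h : ∀ S ⊆ F, f S = g S) :
    bernoulliExp q F f = bernoulliExp q F g := by
  unfold bernoulliExp
  exact Finset.sum_congr rfl fun S hS => by rw [h S (Finset.mem_powerset.1 hS)]

theorem bernoulliExp_mono (hq : ∀ i, q i ∈ Set.Icc (0 : ℝ) 1) (h : ∀ S ⊆ F, f S ≤ g S) :
    bernoulliExp q F f ≤ bernoulliExp q F g := by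
  unfold bernoulliExp
  refine Finset.sum_le_sum fun S hS =>
    mul_le_mul_of_nonneg_left (h S (Finset.mem_powerset.1 hS)) ?_
  exact mul_nonneg (Finset.prod_nonneg fun i _ => (hq i).1)
    (Finset.prod_nonneg fun i _ => sub_nonneg.2 (hq i).2)

theorem bernoulliExp_sub (q : ι → ℝ) (F : Finset ι) (f g : Finset ι → ℝ) :
    bernoulliExp q F (fun S => f S - g S) = bernoulliExp q F f - bernoulliExp q F g := by
  simp only [bernoulliExp, mul_sub, Finset.sum_sub_distrib]

theorem bernoulliExp_add (q : ι → ℝ) (F : Finset ι) (f g : Finset ι → ℝ) :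
    bernoulliExp q F (fun S => f S + g S) = bernoulliExp q F f + bernoulliExp q F g := by
  simp only [bernoulliExp, mul_add, Finset.sum_add_distrib]

theorem bernoulliExp_const (q : ι → ℝ) (F : Finset ι) (a : ℝ) :
    bernoulliExp q F (fun _ => a) = a := by
  classical
  induction F using Finset.induction_on with
  | empty => simp
  | insert i F hi ih => rw [bernoulliExp_insert _ _ hi, ih]; ring

theorem bernoulliExp_nonneg (hq : ∀ i, q i ∈ Set.Icc (0 : ℝ) 1) (h : ∀ S ⊆ F, 0 ≤ f S) :
    0 ≤ bernoulliExp q F f := by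
  rw [← bernoulliExp_const q F 0]
  exact bernoulliExp_mono hq h

/-- A bit on which `f` does not depend may be dropped. -/
theorem bernoulliExp_insert_of_irrelevant [DecidableEq ι] (q : ι → ℝ) {i : ι}
    (h : ∀ S ⊆ F, f (insert i S) = f S) :
    bernoulliExp q (insert i F) f = bernoulliExp q F f := by
  by_cases hi : i ∈ F
  · rw [Finset.insert_eq_of_mem hi]
  · rw [bernoulliExp_insert _ _ hi, bernoulliExp_congr_right q h]; ring

theorem bernoulliExp_mono_finset (hq : ∀ i, q i ∈ Set.Icc (0 : ℝ) 1) (hf : Monotone f)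
    (hF : F ⊆ F') : bernoulliExp q F f ≤ bernoulliExp q F' f := by
  classical
  obtain ⟨K, rfl⟩ : ∃ K, F' = F ∪ K := ⟨F', (Finset.union_eq_right.2 hF).symm⟩
  clear hF
  induction K using Finset.induction_on with
  | empty => simp
  | insert i K hi ih =>
    refine ih.trans ?_
    rw [Finset.union_insert]
    by_cases hi : i ∈ F ∪ K
    · rw [Finset.insert_eq_of_mem hi]
    · rw [bernoulliExp_insert _ _ hi]
      have := bernoulliExp_mono (F := F ∪ K) hq (f := f) (g := fun S => f (insert i S))
        fun S _ => hf (Finset.subset_insert i S)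
      nlinarith [(hq i).1, (hq i).2]

theorem bernoulliExp_mono_param (hq : ∀ i, q i ∈ Set.Icc (0 : ℝ) 1)
    (hq' : ∀ i, q' i ∈ Set.Icc (0 : ℝ) 1) (hqq : ∀ i, q i ≤ q' i) (hf : Monotone f) :
    bernoulliExp q F f ≤ bernoulliExp q' F f := by
  classical
  induction F using Finset.induction_on generalizing f with
  | empty => simp
  | insert i F hi ih =>
    rw [bernoulliExp_insert _ _ hi, bernoulliExp_insert _ _ hi]
    have h1 := ih hf
    have h2 := ih (f := fun S => f (insert i S))
      fun S T h => hf (Finset.insert_subset_insert i h)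
    have h3 := bernoulliExp_mono (F := F) hq' (f := f) (g := fun S => f (insert i S))
      fun S _ => hf (Finset.subset_insert i S)
    have h4 := hqq i
    nlinarith [(hq i).1, (hq i).2, (hq' i).1, (hq' i).2]

/-- Russo's formula. -/
theorem hasDerivAt_bernoulliExp [DecidableEq ι] {q : ℝ → ι → ℝ} {q' : ι → ℝ} {t : ℝ}
    (hq : ∀ i, HasDerivAt (fun s => q s i) (q' i) t) (F : Finset ι) (f : Finset ι → ℝ) :
    HasDerivAt (fun s => bernoulliExp (q s) F f)
      (∑ i ∈ F, q' i * bernoulliExp (q t) (F.erase i) (fun S => f (insert i S) - f S)) t := by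
  induction F using Finset.induction_on generalizing f with
  | empty => simpa using hasDerivAt_const t (f ∅)
  | insert j F hj ih =>
    have key := ((hq j).mul (ih (fun S => f (insert j S)))).add
      (((hasDerivAt_const t (1 : ℝ)).sub (hq j)).mul (ih f))
    have e : (fun s => bernoulliExp (q s) (insert j F) f) =
        ((fun s => q s j) * fun s => bernoulliExp (q s) F (fun S => f (insert j S))) +
        ((fun _ => (1 : ℝ)) - fun s => q s j) * fun s => bernoulliExp (q s) F f := by
      funext s
      simp [bernoulliExp_insert _ _ hj]
    rw [e]
    refine key.congr_deriv ?_
    rw [Finset.sum_insert hj, Finset.erase_insert hj, bernoulliExp_sub]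
    have h2 : ∀ i ∈ F, q' i * bernoulliExp (q t) ((insert j F).erase i)
        (fun S => f (insert i S) - f S) =
        q t j * (q' i * bernoulliExp (q t) (F.erase i)
          (fun S => f (insert j (insert i S)) - f (insert j S))) +
        (1 - q t j) * (q' i * bernoulliExp (q t) (F.erase i) (fun S => f (insert i S) - f S)) := by
      intro i hi
      have hij : j ≠ i := fun h => hj (h ▸ hi)
      rw [Finset.erase_insert_of_ne hij, bernoulliExp_insert _ _ (by simp [hj])]
      simp only [Finset.insert_comm i j]
      ring
    rw [Finset.sum_congr rfl h2, Finset.sum_add_distrib, ← Finset.mul_sum, ← Finset.mul_sum]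
    simp only [Pi.sub_apply, bernoulliExp_sub]
    ring

open Classical in
/-- The probability of an event that may be reached by modifying one bit is at most a constant
times the probability of the event. -/
theorem bernoulliExp_modify_one {δ : ℝ} (hδ : 0 < δ) (hq : ∀ i, q i ∈ Set.Icc δ (1 - δ))
    (P : Finset ι → Prop) (i : ι) (hi : i ∈ F) :
    bernoulliExp q F (fun S => if P (insert i S) ∨ P (S.erase i) then 1 else 0) ≤
      δ⁻¹ * bernoulliExp q F (fun S => if P S then 1 else 0) := by
  have hq01 : ∀ i, q i ∈ Set.Icc (0 : ℝ) 1 := fun i =>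
    ⟨hδ.le.trans (hq i).1, (hq i).2.trans (by linarith)⟩
  obtain ⟨F, hiF, rfl⟩ : ∃ F', i ∉ F' ∧ insert i F' = F :=
    ⟨F.erase i, by simp, Finset.insert_erase hi⟩
  rw [bernoulliExp_insert _ _ hiF, bernoulliExp_insert _ _ hiF]
  set a := bernoulliExp q F (fun S => if P (insert i S) then (1 : ℝ) else 0) with ha
  set b := bernoulliExp q F (fun S => if P S then (1 : ℝ) else 0) with hb
  have h0 : ∀ S ⊆ F, i ∉ S := fun S hS h => hiF (hS h)
  have h1 : bernoulliExp q F (fun S => if P (insert i (insert i S)) ∨ P ((insert i S).erase i)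
      then (1 : ℝ) else 0) ≤ a + b := by
    rw [ha, hb, ← bernoulliExp_add]
    refine bernoulliExp_mono hq01 fun S hS => ?_
    rw [Finset.insert_idem, Finset.erase_insert (h0 S hS)]
    by_cases h : P (insert i S) <;> by_cases h' : P S <;> simp [h, h']
  have h2 : bernoulliExp q F (fun S => if P (insert i S) ∨ P (S.erase i)
      then (1 : ℝ) else 0) ≤ a + b := by
    rw [ha, hb, ← bernoulliExp_add]
    refine bernoulliExp_mono hq01 fun S hS => ?_
    rw [Finset.erase_eq_of_notMem (h0 S hS)]
    by_cases h : P (insert i S) <;> by_cases h' : P S <;> simp [h, h']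
  have ha0 : 0 ≤ a := bernoulliExp_nonneg hq01 fun S _ => by split_ifs <;> norm_num
  have hb0 : 0 ≤ b := bernoulliExp_nonneg hq01 fun S _ => by split_ifs <;> norm_num
  -- Both values of the bit `i` have probability at least `δ`.
  have h3 : a + b ≤ δ⁻¹ * (q i * a + (1 - q i) * b) := by
    rw [inv_mul_eq_div, le_div_iff₀ hδ]
    have := (hq i).1; have := (hq i).2
    nlinarith
  refine le_trans ?_ h3
  have := (hq01 i).1; have := (hq01 i).2
  nlinarith

open Classical in
/-- The probability of an event that may be reached by modifying the bits in `N` is at most a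
constant times the probability of the event. -/
theorem bernoulliExp_modify {δ : ℝ} (hδ : 0 < δ) (hq : ∀ i, q i ∈ Set.Icc δ (1 - δ))
    (P : Finset ι → Prop) (N : Finset ι) (hN : N ⊆ F) :
    bernoulliExp q F (fun S => if ∃ S', P S' ∧ ∀ i ∉ N, i ∈ S' ↔ i ∈ S then 1 else 0) ≤
      δ⁻¹ ^ N.card * bernoulliExp q F (fun S => if P S then 1 else 0) := by
  induction N using Finset.induction_on with
  | empty =>
    simp only [Finset.card_empty, pow_zero, one_mul]
    refine le_of_eq (bernoulliExp_congr_right q fun S _ => ?_)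
    congr 1
    refine propext ⟨fun ⟨S', h, h'⟩ => ?_, fun h => ⟨S, h, by simp⟩⟩
    rwa [← Finset.ext fun i => h' i (by simp)]
  | insert j N hj ih =>
    have hN' := Finset.insert_subset_iff.1 hN
    have key := bernoulliExp_modify_one hδ hq
      (fun S => ∃ S', P S' ∧ ∀ i ∉ N, i ∈ S' ↔ i ∈ S) j hN'.1
    rw [Finset.card_insert_of_notMem hj, pow_succ', mul_assoc]
    refine le_trans ?_ (key.trans (mul_le_mul_of_nonneg_left (ih hN'.2) (inv_nonneg.2 hδ.le)))
    refine bernoulliExp_mono (fun i =>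
      ⟨hδ.le.trans (hq i).1, (hq i).2.trans (by linarith)⟩) fun S _ => ?_
    split_ifs with h1 h2 h2
    · rfl
    · exfalso
      obtain ⟨S', hP, hS'⟩ := h1
      apply h2
      -- Give the bit `j` the value it has in `S'`; what remains is a modification on `N`.
      by_cases hjS : j ∈ S'
      · refine Or.inl ⟨S', hP, fun i hi => ?_⟩
        by_cases hij : i = j
        · subst hij; simp [hjS]
        · simpa [hij] using hS' i (by simp [hij, hi])
      · refine Or.inr ⟨S', hP, fun i hi => ?_⟩
        by_cases hij : i = j
        · subst hij; simp [hjS]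
        · simpa [hij] using hS' i (by simp [hij, hi])
    · norm_num
    · rfl

end FiniteBernoulli

/-! ### Finite-dimensional events of Bernoulli percolation -/

section Cylinder

open MeasureTheory ProbabilityTheory

variable {ι : Type*}

theorem measurableSet_mem_set (i : ι) : MeasurableSet {S : Set ι | i ∈ S} := by
  have := MeasurableEquiv.setOfPred (α := ι).symm.measurable
  exact (measurable_pi_apply i).comp this (MeasurableSet.of_discrete (s := {True})) |>.congr
    (by ext S; simp [MeasurableEquiv.setOfPred])

theorem setBernoulli_inter_eq [DecidableEq ι] (u : Set ι) (p : I) {F S₀ : Finset ι}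
    (hF : (F : Set ι) ⊆ u) (hS : S₀ ⊆ F) :
    (setBernoulli u p).real {S | S ∩ F = S₀} = (p : ℝ) ^ S₀.card * (1 - p : ℝ) ^ (F \ S₀).card := by
  classical
  rw [measureReal_def, setBernoulli_apply']
  have e : (fun P : ι → Prop => {i | P i}) ⁻¹' {S : Set ι | S ∩ F = S₀} =
      Set.pi F fun i => {i ∈ S₀} := by
    ext P
    simp only [Set.mem_preimage, Set.mem_ofPred_eq, Set.ext_iff, Set.mem_inter_iff, Set.mem_pi,
      Finset.mem_coe, Set.mem_singleton_iff, eq_iff_iff]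
    exact ⟨fun h i hi => ⟨fun hP => (h i).1 ⟨hP, hi⟩, fun hP => ((h i).2 hP).1⟩,
      fun h i => ⟨fun hP => (h i hP.2).1 hP.1, fun hP => ⟨(h i (hS hP)).2 hP, hS hP⟩⟩⟩
  rw [e, Measure.infinitePi_pi _ (fun _ _ => MeasurableSet.of_discrete), ENNReal.toReal_prod]
  have h1 : ∀ i ∈ F, ((unitInterval.toNNReal p • Measure.dirac (i ∈ u) +
      unitInterval.toNNReal (unitInterval.symm p) • Measure.dirac False : Measure Prop)
        {i ∈ S₀}).toReal = if i ∈ S₀ then (p : ℝ) else 1 - p := by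
    intro i hi
    have hu : i ∈ u := hF hi
    by_cases h : i ∈ S₀ <;> simp [hu, h]
  rw [Finset.prod_congr rfl h1, Finset.prod_ite, Finset.prod_const, Finset.prod_const,
    Finset.filter_mem_eq_inter, Finset.inter_eq_right.2 hS, Finset.filter_notMem_eq_sdiff]

open Classical in
/-- The probability of an event that depends on finitely many edges only. -/
theorem setBernoulli_real_inter (u : Set ι) (p : I) {F : Finset ι} (hF : (F : Set ι) ⊆ u)
    (P : Set ι → Prop) :
    (setBernoulli u p).real {S | P (S ∩ F)} =
      bernoulliExp (fun _ => (p : ℝ)) F (fun S => if P S then 1 else 0) := by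
  have hmeas : ∀ S₀ : Finset ι, MeasurableSet {S : Set ι | S ∩ F = S₀} := by
    intro S₀
    have : {S : Set ι | S ∩ F = S₀} =
        if S₀ ⊆ F then ⋂ i ∈ F, {S : Set ι | i ∈ S ↔ i ∈ S₀} else ∅ := by
      split_ifs with h
      · ext S
        simp only [Set.ext_iff, Set.mem_ofPred_eq, Set.mem_inter_iff, Finset.mem_coe,
          Set.mem_iInter]
        exact ⟨fun h' i hi => ⟨fun hP => (h' i).1 ⟨hP, hi⟩, fun hP => ((h' i).2 hP).1⟩,
          fun h' i => ⟨fun hP => (h' i hP.2).1 hP.1, fun hP => ⟨(h' i (h hP)).2 hP, h hP⟩⟩⟩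
      · ext S
        simp only [Set.mem_ofPred_eq, Set.mem_empty_iff_false, iff_false]
        intro h'
        exact h fun i hi => by
          have : i ∈ S ∩ (F : Set ι) := h' ▸ Finset.mem_coe.2 hi
          exact this.2
    rw [this]
    split_ifs
    · refine Finset.measurableSet_biInter _ fun i _ => ?_
      by_cases hi : i ∈ S₀
      · simpa [hi] using measurableSet_mem_set i
      · simp only [hi, iff_false]
        exact (measurableSet_mem_set i).compl
    · exact MeasurableSet.empty
  have e : {S : Set ι | P (S ∩ F)} =
      ⋃ S₀ ∈ F.powerset.filter fun S₀ : Finset ι => P (S₀ : Set ι), {S : Set ι | S ∩ F = S₀} := by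
    ext S
    simp only [Set.mem_ofPred_eq, Set.mem_iUnion, Finset.mem_filter, Finset.mem_powerset,
      exists_prop]
    constructor
    · intro h
      have e : ((F.filter fun i => i ∈ S : Finset ι) : Set ι) = S ∩ F := by
        ext i; simp [and_comm]
      exact ⟨F.filter fun i => i ∈ S, ⟨Finset.filter_subset _ _, e ▸ h⟩, e.symm⟩
    · rintro ⟨S₀, ⟨-, h⟩, h'⟩
      rwa [h']
  rw [e, measureReal_biUnion_finset _ fun S₀ _ => hmeas S₀, Finset.sum_filter]
  · unfold bernoulliExp
    refine Finset.sum_congr rfl fun S₀ hS₀ => ?_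
    rw [setBernoulli_inter_eq u p hF (Finset.mem_powerset.1 hS₀)]
    simp
  · intro S₁ _ S₂ _ h
    refine Set.disjoint_left.2 fun S h1 h2 => h ?_
    exact Finset.coe_injective (h1.symm.trans h2)

/-- The probability that finitely many given edges are open. -/
theorem setBernoulli_real_superset (u : Set ι) (p : I) {F : Finset ι} (hF : (F : Set ι) ⊆ u) :
    (setBernoulli u p).real {S | (F : Set ι) ⊆ S} = (p : ℝ) ^ F.card := by
  classical
  have : {S : Set ι | (F : Set ι) ⊆ S} = {S : Set ι | S ∩ F = F} := by
    ext S; simp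
  rw [this, setBernoulli_inter_eq u p hF subset_rfl]
  simp

end Cylinder

/-! ### Partitions of a graph into connected cells -/

section Cells

variable {W : Type*}

/-- The fibres of `c` are cells of `H`: the cell of `w` has the centre `c w`, is star-shaped with
radius at most `D` around it, and contains the ball of radius `R` around it. -/
structure IsCellMap (H : SimpleGraph W) (c : W → W) (R D : ℕ) : Prop where
  idem : ∀ w, c (c w) = c w
  exists_path : ∀ w, ∃ p : H.Walk (c w) w, p.IsPath ∧ p.length ≤ D ∧ ∀ v ∈ p.support, c v = c w
  ball : ∀ u w, c u = u → H.dist u w ≤ R → c w = u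

/-- Zorn's lemma: a point far from a maximal separated set could be added to it. -/
theorem exists_separated_net (H : SimpleGraph W) (r : ℕ) :
    ∃ U : Set W, (U.Pairwise fun a b => r < H.dist a b) ∧ ∀ w, ∃ u ∈ U, H.dist w u ≤ r := by
  obtain ⟨U, hU⟩ := zorn_subset {U : Set W | U.Pairwise fun a b => r < H.dist a b} (by
    intro C hC hchain
    refine ⟨⋃₀ C, ?_, fun s hs => Set.subset_sUnion_of_mem hs⟩
    exact (Set.pairwise_sUnion hchain.directedOn).2 fun s hs => hC hs)
  refine ⟨U, hU.prop, fun w => ?_⟩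
  by_contra! h
  have hw : w ∉ U := fun hw => by simpa using h w hw
  refine hw (hU.le_of_ge (y := insert w U) ?_ (Set.subset_insert w U) (Set.mem_insert w U))
  exact Set.pairwise_insert.2 ⟨hU.prop, fun b hb _ =>
    ⟨h b hb, by rw [SimpleGraph.dist_comm]; exact h b hb⟩⟩

/-- Every vertex outside the net has a neighbour (`par`) strictly closer to the net. Following these
parents for `2 * R` steps ends in the net and defines `c`; a whole descent stays in one cell, whence
the paths. If `w` is within `R` of a net point `u`, then its descent also has length at most `R`, so
`c w` and `u` are at distance at most `2 * R` and coincide by separation. -/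
theorem exists_isCellMap {H : SimpleGraph W} (hH : H.Connected) (R : ℕ) :
    ∃ c, IsCellMap H c R (2 * R) := by
  classical
  obtain ⟨U, hsep, hnet⟩ := exists_separated_net H (2 * R)
  set d : W → ℕ := fun w => sInf ((fun u => H.dist w u) '' U) with hd
  have hd_mem : ∀ w, ∃ u ∈ U, H.dist w u = d w := fun w => by
    obtain ⟨u, hu, -⟩ := hnet w
    exact Nat.sInf_mem (s := (fun u => H.dist w u) '' U) ⟨_, u, hu, rfl⟩
  have hd_le : ∀ w, ∀ u ∈ U, d w ≤ H.dist w u := fun w u hu => Nat.sInf_le ⟨u, hu, rfl⟩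
  have hdU : ∀ w, d w = 0 ↔ w ∈ U := fun w => by
    constructor
    · intro h
      obtain ⟨u, hu, hu'⟩ := hd_mem w
      rw [h, hH.dist_eq_zero_iff] at hu'
      rwa [hu']
    · intro h
      simpa using hd_le w w h
  have hdR : ∀ w, d w ≤ 2 * R := fun w => by
    obtain ⟨u, hu, hu'⟩ := hnet w
    exact (hd_le w u hu).trans hu'
  have hpar : ∀ w, ∃ w', (w ∈ U → w' = w) ∧ (w ∉ U → H.Adj w w' ∧ d w' < d w) := fun w => by
    by_cases hw : w ∈ U
    · exact ⟨w, fun _ => rfl, fun h => absurd hw h⟩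
    · obtain ⟨u, hu, hu'⟩ := hd_mem w
      obtain ⟨p, hp⟩ := hH.exists_walk_length_eq_dist w u
      cases p with
      | nil => exact absurd hu hw
      | cons hadj p =>
        rename_i w'
        refine ⟨w', fun h => absurd h hw, fun _ => ⟨hadj, ?_⟩⟩
        have h1 := hd_le w' u hu
        have h2 := SimpleGraph.dist_le p
        rw [SimpleGraph.Walk.length_cons] at hp
        omega
  choose par hparU hparN using hpar
  have hiter : ∀ n w, d w ≤ n → par^[n] w ∈ U := by
    intro n
    induction n with
    | zero => intro w h; exact (hdU w).1 (by omega)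
    | succ n ih =>
      intro w h
      rw [Function.iterate_succ_apply]
      by_cases hw : w ∈ U
      · rw [hparU w hw]; exact ih w (by rw [(hdU w).2 hw]; omega)
      · exact ih _ (by have := (hparN w hw).2; omega)
  set c : W → W := par^[2 * R] with hc
  have hcU : ∀ w, c w ∈ U := fun w => hiter _ w (hdR w)
  have hcfix : ∀ u ∈ U, c u = u := fun u hu => Function.iterate_fixed (hparU u hu) _
  have hcpar : ∀ w, c (par w) = c w := fun w => by
    rw [hc, ← Function.iterate_succ_apply, Function.iterate_succ_apply']
    exact hparU _ (hcU w)
  have hwalk : ∀ n w, d w ≤ n →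
      ∃ p : H.Walk (c w) w, p.length ≤ d w ∧ ∀ v ∈ p.support, c v = c w := by
    intro n
    induction n with
    | zero =>
      intro w h
      have hw := (hdU w).1 (by omega)
      rw [hcfix w hw]
      exact ⟨.nil, by simp, by simp [hcfix w hw]⟩
    | succ n ih =>
      intro w h
      by_cases hw : w ∈ U
      · rw [hcfix w hw]
        exact ⟨.nil, by simp, by simp [hcfix w hw]⟩
      · obtain ⟨hadj, hlt⟩ := hparN w hw
        obtain ⟨p, hp, hs⟩ := ih (par w) (by omega)
        rw [← hcpar w]
        refine ⟨p.concat hadj.symm, by rw [SimpleGraph.Walk.length_concat]; omega, fun v hv => ?_⟩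
        rw [SimpleGraph.Walk.support_concat] at hv
        simp only [List.mem_append, List.mem_singleton] at hv
        rcases hv with hv | rfl
        · exact hs v hv
        · exact (hcpar _).symm
  refine ⟨c, fun w => hcfix _ (hcU w), fun w => ?_, fun u w hu huw => ?_⟩
  · obtain ⟨p, hp, hs⟩ := hwalk _ w le_rfl
    exact ⟨p.bypass, p.bypass_isPath, (p.length_bypass_le_length).trans (hp.trans (hdR w)),
      fun v hv => hs v (p.support_bypass_subset_support hv)⟩
  · have huU : u ∈ U := hu ▸ hcU u
    obtain ⟨p, hp, -⟩ := hwalk _ w le_rfl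
    have h1 := SimpleGraph.dist_le p
    have h2 := hd_le w u huU
    rw [SimpleGraph.dist_comm] at h2
    by_contra hne
    have h3 := hsep (hcU w) huU hne
    have h4 := hH.dist_triangle (u := c w) (v := w) (w := u)
    rw [SimpleGraph.dist_comm (u := w)] at h4
    omega

end Cells

/-! ### The enhanced cluster -/

section Enhancement

variable {W : Type*}

/-- The enhanced cluster of `o`. The configuration `X` consists of open edges and active centres of
cells. If the whole cell of an active centre has been reached and all edges inside it are open, then
all neighbours of the cell are reached as well. -/
inductive EnhReach (H : SimpleGraph W) (c : W → W) (o : W) (X : Set (Sym2 W ⊕ W)) : W → Prop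
  | base : EnhReach H c o X o
  | edge {x y : W} : EnhReach H c o X x → H.Adj x y → Sum.inl s(x, y) ∈ X → EnhReach H c o X y
  | enh {u x y : W} : Sum.inr u ∈ X → (∀ w, c w = u → EnhReach H c o X w) →
      (∀ a b, H.Adj a b → c a = u → c b = u → Sum.inl s(a, b) ∈ X) → c x = u → H.Adj x y →
      EnhReach H c o X y

variable {H : SimpleGraph W} {c : W → W} {o : W} {X Y : Set (Sym2 W ⊕ W)} {T : Set W}

theorem EnhReach.mono (h : X ⊆ Y) {w : W} (hw : EnhReach H c o X w) : EnhReach H c o Y w := by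
  induction hw with
  | base => exact .base
  | edge _ hadj he ih => exact .edge ih hadj (h he)
  | enh hu _ ho hx hadj ih =>
    exact .enh (h hu) ih (fun a b hab ha hb => h (ho a b hab ha hb)) hx hadj

/-- The enhanced cluster of `o` meets `T`. -/
def EnhHits (H : SimpleGraph W) (c : W → W) (o : W) (T : Set W) (X : Set (Sym2 W ⊕ W)) : Prop :=
  ∃ w ∈ T, EnhReach H c o X w

theorem EnhHits.mono (h : X ⊆ Y) (hX : EnhHits H c o T X) : EnhHits H c o T Y :=
  let ⟨w, hw, hr⟩ := hX
  ⟨w, hw, hr.mono h⟩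

/-- The bits attached to the cell with centre `u`: its activity, and the edges touching it. -/
def cellBits (H : SimpleGraph W) (c : W → W) (u : W) : Set (Sym2 W ⊕ W) :=
  {i | i = Sum.inr u ∨ ∃ x y, H.Adj x y ∧ c x = u ∧ i = Sum.inl s(x, y)}

theorem mem_cellBits_edge {u x y : W} (hadj : H.Adj x y) :
    Sum.inl s(x, y) ∈ cellBits H c u ↔ c x = u ∨ c y = u := by
  constructor
  · rintro (h | ⟨a, b, hab, ha, h⟩)
    · cases h
    · rw [Sum.inl.injEq, Sym2.eq_iff] at h
      rcases h with ⟨rfl, rfl⟩ | ⟨rfl, rfl⟩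
      · exact Or.inl ha
      · exact Or.inr ha
  · rintro (h | h)
    · exact Or.inr ⟨x, y, hadj, h, rfl⟩
    · exact Or.inr ⟨y, x, hadj.symm, h, by rw [Sym2.eq_swap]⟩

/-- If an edge touching a cell is pivotal, then one may modify the bits attached to the cell so that
its activity becomes pivotal. -/
theorem exists_pivotal_activity {R D : ℕ} (hc : IsCellMap H c R D)
    (hT : ∀ w, w ∈ T → c w ∈ T)
    {u a b : W} (hu : c u = u) (huT : u ∉ T) (hab : H.Adj a b) (ha : c a = u)
    (h0 : ¬ EnhHits H c o T (X \ {Sum.inl s(a, b)}))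
    (h1 : EnhHits H c o T (insert (Sum.inl s(a, b)) X)) :
    ∃ X' : Set (Sym2 W ⊕ W), EnhHits H c o T (insert (Sum.inr u) X') ∧
      ¬ EnhHits H c o T (X' \ {Sum.inr u}) ∧ ∀ i ∉ cellBits H c u, i ∈ X' ↔ i ∈ X := by
  set N := cellBits H c u with hN
  have heN : Sum.inl s(a, b) ∈ N := (mem_cellBits_edge hab).2 (Or.inl ha)
  -- All bits of the cell are switched off before the useful ones are switched on again.
  set X1 := X \ N with hX1
  have hX1X : X1 ⊆ X \ {Sum.inl s(a, b)} := fun i hi =>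
    ⟨hi.1, fun h => hi.2 (by rw [Set.mem_singleton_iff.1 h]; exact heN)⟩
  have h01 : ¬ EnhHits H c o T X1 := fun h => h0 (h.mono hX1X)
  -- an inner edge of another cell is not attached to the cell `u`
  have hother : ∀ {u' x y : W}, u' ≠ u → H.Adj x y → c x = u' → c y = u' →
      Sum.inl s(x, y) ∉ N := by
    intro u' x y hne hadj hx hy h
    rcases (mem_cellBits_edge hadj).1 h with h | h
    · exact hne (hx.symm.trans h)
    · exact hne (hy.symm.trans h)
  have hmem : ∀ {i}, i ∈ insert (Sum.inl s(a, b)) X → i ∉ N → i ∈ X1 := by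
    rintro i (rfl | hi) hiN
    · exact absurd heN hiN
    · exact ⟨hi, hiN⟩
  have hinr : ∀ {u' : W}, u' ≠ u → Sum.inr u' ∉ N := by
    rintro u' hne (h | ⟨_, _, _, _, h⟩)
    · exact hne (Sum.inr.inj h)
    · cases h
  -- The cluster in `X1` must meet the cell or be adjacent to it: otherwise the bits of the cell
  -- never come into play, and `T` would be hit already in `X1`.
  have hentry : ∃ w x, EnhReach H c o X1 w ∧ c x = u ∧ (w = x ∨ H.Adj w x) := by
    by_contra! hcon
    have hfar : ∀ w, EnhReach H c o X1 w → c w ≠ u := fun w hw hwu => (hcon w w hw hwu).1 rfl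
    have hfar' : ∀ w x, EnhReach H c o X1 w → H.Adj w x → c x ≠ u :=
      fun w x hw hwx hx => (hcon w x hw hx).2 hwx
    obtain ⟨t, ht, hr⟩ := h1
    refine h01 ⟨t, ht, ?_⟩
    clear ht
    induction hr with
    | base => exact .base
    | edge _ hadj he ih =>
      refine .edge ih hadj (hmem he fun h => ?_)
      rcases (mem_cellBits_edge hadj).1 h with h | h
      · exact hfar _ ih h
      · exact hfar' _ _ ih hadj h
    | @enh u' x y hu' _ ho hx hadj ih =>
      have hne : u' ≠ u := by
        rintro rfl
        exact hfar _ (ih _ hu) hu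
      exact .enh (hmem hu' (hinr hne)) ih
        (fun p q hpq hp hq => hmem (ho p q hpq hp hq) (hother hne hpq hp hq)) hx hadj
  obtain ⟨w, x, hw, hx, hwx⟩ := hentry
  -- `B` holds the inner edges of the cell and `J` the edge of entry; `J` is empty when `w = x`
  -- already lies in the cell.
  set B : Set (Sym2 W ⊕ W) := {i | ∃ p q, H.Adj p q ∧ c p = u ∧ c q = u ∧ i = Sum.inl s(p, q)}
    with hB
  set J : Set (Sym2 W ⊕ W) := {i | H.Adj w x ∧ i = Sum.inl s(w, x)} with hJ
  set X0 := X1 ∪ B ∪ J with hX0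
  have hX0_inr : ∀ {u' : W}, Sum.inr u' ∈ X0 → Sum.inr u' ∈ X1 := by
    rintro u' ((h | ⟨_, _, _, _, _, h⟩) | ⟨_, h⟩)
    · exact h
    · cases h
    · cases h
  -- With `u` inactive, opening `B` and `J` adds at most the cell of `u` itself to the cluster, and
  -- this cell is disjoint from `T`.
  have hreach0 : ∀ z, EnhReach H c o X0 z → EnhReach H c o X1 z ∨ c z = u := by
    intro z hz
    induction hz with
    | base => exact Or.inl .base
    | @edge p q _ hadj he ih =>
      rcases he with (he | ⟨p', q', hadj', hp', hq', he⟩) | ⟨_, he⟩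
      · rcases ih with ih | ih
        · exact Or.inl (.edge ih hadj he)
        · exact absurd ((mem_cellBits_edge hadj).2 (Or.inl ih)) he.2
      · rw [Sum.inl.injEq, Sym2.eq_iff] at he
        rcases he with ⟨rfl, rfl⟩ | ⟨rfl, rfl⟩
        · exact Or.inr hq'
        · exact Or.inr hp'
      · rw [Sum.inl.injEq, Sym2.eq_iff] at he
        rcases he with ⟨rfl, rfl⟩ | ⟨rfl, rfl⟩
        · exact Or.inr hx
        · exact Or.inl hw
    | @enh u' p q hu' _ ho hx' hadj ih =>
      have hu1 := hX0_inr hu'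
      have hne : u' ≠ u := by
        rintro rfl
        exact hu1.2 (Or.inl rfl)
      refine Or.inl (.enh hu1 (fun z hz => ?_) (fun p' q' hpq hp hq => ?_) hx' hadj)
      · exact (ih z hz).resolve_right fun h => hne (hz.symm.trans h)
      · rcases ho p' q' hpq hp hq with (he | ⟨p'', q'', hadj', hp'', hq'', he⟩) | ⟨_, he⟩
        · exact he
        · exact absurd (he ▸ Or.inr ⟨p'', q'', hadj', hp'', rfl⟩) (hother hne hpq hp hq)
        · rw [Sum.inl.injEq, Sym2.eq_iff] at he
          rcases he with ⟨rfl, rfl⟩ | ⟨rfl, rfl⟩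
          · exact absurd (hq.symm.trans hx) hne
          · exact absurd (hp.symm.trans hx) hne
  have hX0u : Sum.inr u ∉ X0 := fun h => (hX0_inr h).2 (Or.inl rfl)
  refine ⟨X0, ?_, ?_, fun i hi => ?_⟩
  -- With `u` active, the whole cell and all its neighbours are reached, so nothing reached with the
  -- help of the original bits of the cell is lost.
  · set X2 := insert (Sum.inr u) X0 with hX2
    have hX02 : X0 ⊆ X2 := Set.subset_insert _ _
    have hX12 : X1 ⊆ X2 := fun i hi => hX02 (Or.inl (Or.inl hi))
    have hB2 : ∀ p q, H.Adj p q → c p = u → c q = u → Sum.inl s(p, q) ∈ X2 :=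
      fun p q hpq hp hq => hX02 (Or.inl (Or.inr ⟨p, q, hpq, hp, hq, rfl⟩))
    have hxr : EnhReach H c o X2 x := by
      rcases hwx with rfl | hadj
      · exact hw.mono hX12
      · exact .edge (hw.mono hX12) hadj (hX02 (Or.inr ⟨hadj, rfl⟩))
    have hwalk : ∀ {p q : W} (π : H.Walk p q), (∀ v ∈ π.support, c v = u) →
        EnhReach H c o X2 p → EnhReach H c o X2 q := by
      intro p q π
      induction π with
      | nil => exact fun _ h => h
      | cons hadj π ih =>
        intro hs hp
        simp only [SimpleGraph.Walk.support_cons, List.mem_cons, forall_eq_or_imp] at hs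
        exact ih hs.2 (.edge hp hadj (hB2 _ _ hadj hs.1 (hs.2 _ π.start_mem_support)))
    have hur : EnhReach H c o X2 u := by
      obtain ⟨π, -, -, hs⟩ := hc.exists_path x
      have hxu := hwalk π.reverse (fun v hv => (hs v (by simpa using hv)).trans hx) hxr
      rwa [hx] at hxu
    have hcell : ∀ z, c z = u → EnhReach H c o X2 z := by
      intro z hz
      obtain ⟨π, -, -, hs⟩ := hc.exists_path z
      exact hwalk π (fun v hv => (hs v hv).trans hz) (by rwa [hz])
    have hbdry : ∀ p q, c p = u → H.Adj p q → EnhReach H c o X2 q := fun p q hp hpq =>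
      .enh (Set.mem_insert _ _) hcell hB2 hp hpq
    obtain ⟨t, ht, hr⟩ := h1
    refine ⟨t, ht, ?_⟩
    clear ht
    induction hr with
    | base => exact .base
    | @edge p q _ hadj he ih =>
      by_cases hpN : Sum.inl s(p, q) ∈ N
      · rcases (mem_cellBits_edge hadj).1 hpN with h | h
        · exact hbdry p q h hadj
        · exact hcell q h
      · exact .edge ih hadj (hX12 (hmem he hpN))
    | @enh u' p q hu' _ ho hx' hadj ih =>
      by_cases hne : u' = u
      · subst hne
        exact hbdry p q hx' hadj
      · exact .enh (hX12 (hmem hu' (hinr hne))) ih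
          (fun p q hpq hp hq => hX12 (hmem (ho p q hpq hp hq) (hother hne hpq hp hq))) hx' hadj
  · rw [Set.sdiff_singleton_eq_self hX0u]
    rintro ⟨t, ht, hr⟩
    rcases hreach0 t hr with h | h
    · exact h01 ⟨t, ht, h⟩
    · exact huT (h ▸ hT t ht)
  · constructor
    · rintro ((h | ⟨p, q, hpq, hp, hq, rfl⟩) | ⟨hadj, rfl⟩)
      · exact h.1
      · exact absurd ((mem_cellBits_edge hpq).2 (Or.inl hp)) hi
      · exact absurd ((mem_cellBits_edge hadj).2 (Or.inr hx)) hi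
    · exact fun h => Or.inl (Or.inl ⟨h, hi⟩)

end Enhancement

/-! ### Comparing the effects of edges and of activities -/

section DifferentialInequality

variable {W : Type*}

/-- `F` consists of the edges of `H` touching the complement of `T`, and of the centres of the cells
in the complement of `T`. -/
structure IsVolume (H : SimpleGraph W) (c : W → W) (T : Set W) (F : Finset (Sym2 W ⊕ W)) :
    Prop where
  cell : ∀ w, c w ∈ T ↔ w ∈ T
  edge : ∀ e, Sum.inl e ∈ F ↔ ∃ x y, H.Adj x y ∧ x ∉ T ∧ e = s(x, y)
  centre : ∀ u, Sum.inr u ∈ F ↔ c u = u ∧ u ∉ T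

/-- Edges are open with probability `p`, and cells are active with probability `s`. -/
def enhParam (W : Type*) (p s : ℝ) : Sym2 W ⊕ W → ℝ :=
  Sum.elim (fun _ => p) (fun _ => s)

open Classical in
/-- The probability that the enhanced cluster of `o` in the finite volume `F` meets `T`. -/
noncomputable def enhProb (H : SimpleGraph W) (c : W → W) (o : W) (T : Set W)
    (F : Finset (Sym2 W ⊕ W)) (p s : ℝ) : ℝ :=
  bernoulliExp (enhParam W p s) F (fun S => if EnhHits H c o T (S : Set (Sym2 W ⊕ W)) then 1 else 0)

variable {H : SimpleGraph W} {c : W → W} {o : W} {T : Set W} {F : Finset (Sym2 W ⊕ W)} {R D : ℕ}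

open Classical in
theorem monotone_indicator_enhHits (H : SimpleGraph W) (c : W → W) (o : W) (T : Set W) :
    Monotone (fun S : Finset (Sym2 W ⊕ W) =>
      if EnhHits H c o T (S : Set (Sym2 W ⊕ W)) then (1 : ℝ) else 0) := by
  intro S S' h
  by_cases h1 : EnhHits H c o T (S : Set (Sym2 W ⊕ W))
  · have h2 : EnhHits H c o T (S' : Set (Sym2 W ⊕ W)) := h1.mono (Finset.coe_subset.2 h)
    simp [h1, h2]
  · simp only [h1, if_false]
    split_ifs <;> norm_num

theorem enhParam_mem_Icc {p s a b : ℝ} (hp : p ∈ Set.Icc a b) (hs : s ∈ Set.Icc a b)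
    (i : Sym2 W ⊕ W) : enhParam W p s i ∈ Set.Icc a b := by
  cases i
  · exact hp
  · exact hs

theorem enhProb_mono {p s p' s' : ℝ} (hp : p ∈ Set.Icc (0 : ℝ) 1) (hs : s ∈ Set.Icc (0 : ℝ) 1)
    (hp' : p' ∈ Set.Icc (0 : ℝ) 1) (hs' : s' ∈ Set.Icc (0 : ℝ) 1) (hpp : p ≤ p') (hss : s ≤ s') :
    enhProb H c o T F p s ≤ enhProb H c o T F p' s' := by
  refine bernoulliExp_mono_param (enhParam_mem_Icc hp hs) (enhParam_mem_Icc hp' hs') ?_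
    (monotone_indicator_enhHits H c o T)
  rintro (e | u)
  · exact hpp
  · exact hss

/-- The bit `i` is pivotal for the event that the enhanced cluster meets `T`. -/
def EnhPivotal [DecidableEq (Sym2 W ⊕ W)] (H : SimpleGraph W) (c : W → W) (o : W) (T : Set W)
    (i : Sym2 W ⊕ W) (S : Finset (Sym2 W ⊕ W)) : Prop :=
  EnhHits H c o T (insert i S : Finset _) ∧ ¬ EnhHits H c o T (S.erase i : Finset _)

-- The increment in Russo's formula is the indicator of pivotality, which ignores the bit `i`; hence
-- `i` may be restored to the index set.
open Classical in
theorem bernoulliExp_sub_eq_pivotal (q : Sym2 W ⊕ W → ℝ) {i : Sym2 W ⊕ W} (hi : i ∈ F) :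
    bernoulliExp q (F.erase i) (fun S =>
      (if EnhHits H c o T (insert i S : Finset _) then (1 : ℝ) else 0) -
        if EnhHits H c o T (S : Set (Sym2 W ⊕ W)) then 1 else 0) =
    bernoulliExp q F (fun S => if EnhPivotal H c o T i S then 1 else 0) := by
  nth_rewrite 2 [← Finset.insert_erase hi]
  rw [bernoulliExp_insert_of_irrelevant q (f := fun S => if EnhPivotal H c o T i S then (1:ℝ) else 0)]
  · refine bernoulliExp_congr_right q fun S hS => ?_
    have hiS : i ∉ S := fun h => by simpa using hS h
    have hmono : EnhHits H c o T (S : Set (Sym2 W ⊕ W)) →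
        EnhHits H c o T ((insert i S : Finset _) : Set (Sym2 W ⊕ W)) :=
      EnhHits.mono (Finset.coe_subset.2 (Finset.subset_insert i S))
    unfold EnhPivotal
    rw [Finset.erase_eq_of_notMem hiS]
    by_cases h1 : EnhHits H c o T (S : Set (Sym2 W ⊕ W))
    · rw [if_pos (hmono h1), if_pos h1, if_neg fun h => h.2 h1, sub_self]
    · simp [h1]
  · intro S hS
    have hiS : i ∉ S := fun h => by simpa using hS h
    unfold EnhPivotal
    rw [Finset.erase_eq_of_notMem hiS, Finset.erase_insert hiS, Finset.insert_idem]

-- Every configuration in which the edge is pivotal becomes, after changing at most `M` bits, one in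
-- which the activity is pivotal, so `bernoulliExp_modify` applies.
open Classical in
theorem pivotal_edge_le (hc : IsCellMap H c R D) (hF : IsVolume H c T F) {M : ℕ}
    (hM : ∀ u, (F.filter (· ∈ cellBits H c u)).card ≤ M) {δ : ℝ} (hδ : 0 < δ)
    {q : Sym2 W ⊕ W → ℝ} (hq : ∀ i, q i ∈ Set.Icc δ (1 - δ)) {u x y : W}
    (hxy : H.Adj x y) (hxT : x ∉ T) (hu : c x = u) :
    bernoulliExp q F (fun S => if EnhPivotal H c o T (Sum.inl s(x, y)) S then 1 else 0) ≤
      δ⁻¹ ^ M * bernoulliExp q F (fun S => if EnhPivotal H c o T (Sum.inr u) S then 1 else 0) := by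
  have hq01 : ∀ i, q i ∈ Set.Icc (0 : ℝ) 1 := fun i =>
    ⟨hδ.le.trans (hq i).1, (hq i).2.trans (by linarith)⟩
  have hδ1 : 1 ≤ δ⁻¹ := by
    have := hq (Sum.inr u)
    exact (one_le_inv₀ hδ).2 (by have := this.1.trans this.2; linarith)
  set N := F.filter (· ∈ cellBits H c u) with hN
  have h0 : (0 : ℝ) ≤ bernoulliExp q F
      (fun S => if EnhPivotal H c o T (Sum.inr u) S then 1 else 0) :=
    bernoulliExp_nonneg hq01 fun S _ => by split_ifs <;> norm_num
  refine le_trans ?_ (mul_le_mul_of_nonneg_right (pow_le_pow_right₀ hδ1 (hM u)) h0)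
  refine le_trans ?_ (bernoulliExp_modify hδ hq _ N (Finset.filter_subset _ _))
  refine bernoulliExp_mono hq01 fun S hS => ?_
  by_cases hP : EnhPivotal H c o T (Sum.inl s(x, y)) S
  · rw [if_pos hP, if_pos]
    have huu : c u = u := hu ▸ hc.idem x
    have huT : u ∉ T := fun h => hxT ((hF.cell x).1 (hu ▸ h))
    obtain ⟨X', h1, h2, h3⟩ := exists_pivotal_activity (X := (S : Set (Sym2 W ⊕ W))) hc
      (fun w => (hF.cell w).2) huu huT hxy hu (by simpa using hP.2) (by simpa using hP.1)
    -- The cell lies outside `T`, so all its bits belong to the volume and the modified `X'` is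
    -- again a subset of `F`.
    have hcell : ∀ i ∈ cellBits H c u, i ∈ F := by
      rintro i (rfl | ⟨a, b, hab, ha, rfl⟩)
      · exact (hF.centre u).2 ⟨huu, huT⟩
      · exact (hF.edge _).2 ⟨a, b, hab, fun h => huT (ha ▸ (hF.cell a).2 h), rfl⟩
    set S' : Finset (Sym2 W ⊕ W) := F.filter (· ∈ X') with hS'
    have hSX : (S' : Set (Sym2 W ⊕ W)) = X' := by
      ext i
      simp only [hS', Finset.coe_filter, Set.mem_ofPred_eq, and_iff_right_iff_imp]
      intro hi
      by_cases hic : i ∈ cellBits H c u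
      · exact hcell i hic
      · exact hS ((h3 i hic).1 hi)
    refine ⟨S', ⟨?_, ?_⟩, fun i hi => ?_⟩
    · rwa [Finset.coe_insert, hSX]
    · rwa [Finset.coe_erase, hSX]
    · rw [← Finset.mem_coe, hSX]
      refine h3 i fun hic => hi ?_
      exact Finset.mem_filter.2 ⟨hcell i hic, hic⟩
  · rw [if_neg hP]
    split_ifs <;> norm_num

-- Each edge is charged to the centre of the cell of an endpoint outside `T`; a centre is charged at
-- most `M` times.
open Classical in
theorem sum_pivotal_edges_le (hc : IsCellMap H c R D) (hF : IsVolume H c T F) {M : ℕ}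
    (hM : ∀ u, (F.filter (· ∈ cellBits H c u)).card ≤ M) {δ : ℝ} (hδ : 0 < δ)
    {q : Sym2 W ⊕ W → ℝ} (hq : ∀ i, q i ∈ Set.Icc δ (1 - δ)) :
    ∑ i ∈ F with i.isLeft,
      bernoulliExp q F (fun S => if EnhPivotal H c o T i S then 1 else 0) ≤
    M * δ⁻¹ ^ M * ∑ i ∈ F with ¬ i.isLeft,
      bernoulliExp q F (fun S => if EnhPivotal H c o T i S then 1 else 0) := by
  have hq01 : ∀ i, q i ∈ Set.Icc (0 : ℝ) 1 := fun i =>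
    ⟨hδ.le.trans (hq i).1, (hq i).2.trans (by linarith)⟩
  set g : Sym2 W ⊕ W → ℝ := fun i =>
    bernoulliExp q F (fun S => if EnhPivotal H c o T i S then 1 else 0) with hg
  have hg0 : ∀ i, 0 ≤ g i := fun i =>
    bernoulliExp_nonneg hq01 fun S _ => by split_ifs <;> norm_num
  have hchoice : ∀ i : Sym2 W ⊕ W, ∃ j : Sym2 W ⊕ W, i ∈ F.filter (fun i => i.isLeft) →
      j ∈ F.filter (fun i => ¬ i.isLeft) ∧ g i ≤ δ⁻¹ ^ M * g j ∧
        ∃ u, j = Sum.inr u ∧ i ∈ cellBits H c u := by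
    intro i
    by_cases hi : i ∈ F.filter (fun i => i.isLeft)
    · rw [Finset.mem_filter] at hi
      obtain ⟨hiF, hil⟩ := hi
      obtain ⟨e, rfl⟩ := Sum.isLeft_iff.1 hil
      obtain ⟨x, y, hxy, hxT, rfl⟩ := (hF.edge e).1 hiF
      refine ⟨Sum.inr (c x), fun _ => ⟨?_, ?_, c x, rfl, ?_⟩⟩
      · rw [Finset.mem_filter]
        exact ⟨(hF.centre _).2 ⟨hc.idem x, fun h => hxT ((hF.cell x).1 h)⟩, by simp⟩
      · exact pivotal_edge_le hc hF hM hδ hq hxy hxT rfl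
      · exact (mem_cellBits_edge hxy).2 (Or.inl rfl)
    · exact ⟨i, fun h => absurd h hi⟩
  choose j hj using hchoice
  have hδ0 : 0 ≤ δ⁻¹ ^ M := pow_nonneg (inv_nonneg.2 hδ.le) M
  calc ∑ i ∈ F with i.isLeft, g i
      ≤ ∑ i ∈ F with i.isLeft, δ⁻¹ ^ M * g (j i) := Finset.sum_le_sum fun i hi => (hj i hi).2.1
    _ = ∑ k ∈ F with ¬ k.isLeft, ∑ i ∈ (F.filter fun i => i.isLeft) with j i = k,
          δ⁻¹ ^ M * g (j i) :=
        (Finset.sum_fiberwise_of_maps_to (fun i hi => (hj i hi).1) _).symm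
    _ ≤ ∑ k ∈ F with ¬ k.isLeft, M * (δ⁻¹ ^ M * g k) := by
        refine Finset.sum_le_sum fun k hk => ?_
        have e : ∀ i ∈ (F.filter fun i => i.isLeft).filter (fun i => j i = k),
            δ⁻¹ ^ M * g (j i) = δ⁻¹ ^ M * g k := fun i hi => by
          rw [(Finset.mem_filter.1 hi).2]
        rw [Finset.sum_congr rfl e, Finset.sum_const, nsmul_eq_mul]
        refine mul_le_mul_of_nonneg_right ?_ (mul_nonneg hδ0 (hg0 k))
        rw [Finset.mem_filter] at hk
        obtain ⟨u, rfl⟩ : ∃ u, k = Sum.inr u := by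
          rcases k with e | u
          · simp at hk
          · exact ⟨u, rfl⟩
        refine Nat.cast_le.2 (le_trans (Finset.card_le_card fun i hi => ?_) (hM u))
        rw [Finset.mem_filter] at hi
        obtain ⟨-, -, v, hv, hiv⟩ := hj i hi.1
        rw [hi.2, Sum.inr.injEq] at hv
        subst hv
        exact Finset.mem_filter.2 ⟨(Finset.mem_filter.1 hi.1).1, hiv⟩
    _ = _ := by rw [Finset.mul_sum]; exact Finset.sum_congr rfl fun k _ => by ring

/-- One may trade a decrease of the density of open edges for an increase of the density of active
cells. -/
theorem enhProb_le_of_trade (hc : IsCellMap H c R D) (hF : IsVolume H c T F) {M : ℕ}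
    (hM : ∀ u, {i | i ∈ F ∧ i ∈ cellBits H c u}.ncard ≤ M) {δ : ℝ} (hδ : 0 < δ) {η : ℝ}
    (hη : 0 ≤ η) (hηM : η * (M * δ⁻¹ ^ M) ≤ 1) {p s t : ℝ} (ht : 0 ≤ t)
    (hp : p ≤ 1 - δ) (hp' : δ ≤ p - η * t) (hs : δ ≤ s) (hs' : s + t ≤ 1 - δ) :
    enhProb H c o T F p s ≤ enhProb H c o T F (p - η * t) (s + t) := by
  classical
  have hM' : ∀ u, (F.filter (· ∈ cellBits H c u)).card ≤ M := fun u => by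
    rw [← Set.ncard_coe_finset]
    simpa using hM u
  have hder : ∀ r : ℝ, HasDerivAt (fun r => enhProb H c o T F (p - η * r) (s + r))
      (∑ i ∈ F, enhParam W (-η) 1 i * bernoulliExp (enhParam W (p - η * r) (s + r)) F
        (fun S => if EnhPivotal H c o T i S then 1 else 0)) r := by
    intro r
    have hq : ∀ i, HasDerivAt (fun r => enhParam W (p - η * r) (s + r) i)
        (enhParam W (-η) 1 i) r := by
      rintro (e | u)
      · simpa [enhParam] using ((hasDerivAt_id r).const_mul η).const_sub p
      · simpa [enhParam] using (hasDerivAt_id r).const_add s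
    refine (hasDerivAt_bernoulliExp hq F _).congr_deriv (Finset.sum_congr rfl fun i hi => ?_)
    rw [bernoulliExp_sub_eq_pivotal _ hi]
  have hmono : MonotoneOn (fun r => enhProb H c o T F (p - η * r) (s + r)) (Set.Icc 0 t) := by
    refine monotoneOn_of_deriv_nonneg (convex_Icc 0 t)
      (fun r _ => (hder r).continuousAt.continuousWithinAt)
      (fun r _ => (hder r).differentiableAt.differentiableWithinAt) fun r hr => ?_
    rw [interior_Icc] at hr
    rw [(hder r).deriv]
    have hηr : η * r ≤ η * t := mul_le_mul_of_nonneg_left hr.2.le hη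
    have hηr0 : 0 ≤ η * r := mul_nonneg hη hr.1.le
    have hq : ∀ i, enhParam W (p - η * r) (s + r) i ∈ Set.Icc δ (1 - δ) :=
      enhParam_mem_Icc ⟨by linarith, by linarith⟩ ⟨by linarith [hr.1], by linarith [hr.2]⟩
    have hq01 : ∀ i, enhParam W (p - η * r) (s + r) i ∈ Set.Icc (0 : ℝ) 1 := fun i =>
      ⟨hδ.le.trans (hq i).1, (hq i).2.trans (by linarith)⟩
    have key := sum_pivotal_edges_le (o := o) hc hF hM' hδ hq
    rw [← Finset.sum_filter_add_sum_filter_not F (fun i => i.isLeft)]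
    have e1 : ∀ i ∈ F.filter (fun i => i.isLeft), enhParam W (-η) 1 i = -η := fun i hi => by
      obtain ⟨e, rfl⟩ := Sum.isLeft_iff.1 (Finset.mem_filter.1 hi).2
      rfl
    have e2 : ∀ i ∈ F.filter (fun i => ¬ i.isLeft), enhParam W (-η) 1 i = 1 := fun i hi => by
      rcases i with e | u
      · simp at hi
      · rfl
    rw [Finset.sum_congr rfl fun i hi => by rw [e1 i hi],
      Finset.sum_congr (s₁ := F.filter (fun i => ¬ i.isLeft)) rfl fun i hi => by rw [e2 i hi],
      ← Finset.mul_sum, ← Finset.mul_sum]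
    set A := ∑ i ∈ F with i.isLeft, bernoulliExp (enhParam W (p - η * r) (s + r)) F
      (fun S => if EnhPivotal H c o T i S then (1 : ℝ) else 0)
    set B := ∑ i ∈ F with ¬ i.isLeft, bernoulliExp (enhParam W (p - η * r) (s + r)) F
      (fun S => if EnhPivotal H c o T i S then (1 : ℝ) else 0) with hB
    have hB0 : 0 ≤ B := Finset.sum_nonneg fun i _ =>
      bernoulliExp_nonneg hq01 fun S _ => by split_ifs <;> norm_num
    -- The derivative along the segment is `B - η * A`, nonnegative by the choice of `η`.
    have h1 : η * A ≤ η * (M * δ⁻¹ ^ M * B) := mul_le_mul_of_nonneg_left key hη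
    have h2 : η * (M * δ⁻¹ ^ M) * B ≤ 1 * B := mul_le_mul_of_nonneg_right hηM hB0
    nlinarith
  simpa using hmono (Set.left_mem_Icc.2 ht) (Set.right_mem_Icc.2 ht) ht

end DifferentialInequality

/-! ### Lifting paths -/

section Lifting

/-- Once the edge from `i` to `i + 1` is removed, a walk from `i` cannot go above `i`; so every edge
is a bridge. -/
theorem isAcyclic_pathGraph (n : ℕ) : (SimpleGraph.pathGraph n).IsAcyclic := by
  have key : ∀ i j : Fin n, i.val + 1 = j.val →
      ∀ k, ((SimpleGraph.pathGraph n) \ SimpleGraph.fromEdgeSet {s(i, j)}).Reachable i k →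
        k.val ≤ i.val := by
    intro i j hij k ⟨p⟩
    have : ∀ {a b : Fin n},
        ((SimpleGraph.pathGraph n) \ SimpleGraph.fromEdgeSet {s(i, j)}).Walk a b →
        a.val ≤ i.val → b.val ≤ i.val := by
      intro a b p
      induction p with
      | nil => exact id
      | @cons a b' b h p ih =>
        intro ha
        refine ih ?_
        rw [SimpleGraph.sdiff_adj, SimpleGraph.pathGraph_adj, SimpleGraph.fromEdgeSet_adj] at h
        by_contra hb
        have h1 : a = i := Fin.ext (by omega)
        have h2 : b' = j := Fin.ext (by omega)
        subst h1 h2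
        exact h.2 ⟨rfl, fun h => by have := congrArg Fin.val h; omega⟩
    exact this p le_rfl
  rw [SimpleGraph.isAcyclic_iff_forall_adj_isBridge]
  intro i j hij
  rw [SimpleGraph.isBridge_iff]
  rcases SimpleGraph.pathGraph_adj.1 hij with h | h
  · intro hr
    have := key i j h j hr
    omega
  · intro hr
    rw [Sym2.eq_swap] at hr
    have := key j i h i hr.symm
    omega

variable {V W : Type*} {G : SimpleGraph V} {H : SimpleGraph W} {π : V → W}

theorem isTree_coe_toSubgraph {u v : W} {p : H.Walk u v} (hp : p.IsPath) :
    p.toSubgraph.coe.IsTree := by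
  classical
  exact ⟨p.toSubgraph_connected.coe, hp.pathGraphIsoToSubgraph.isAcyclic_iff.1
    (isAcyclic_pathGraph _)⟩

/-- Turns a lift into a plain function `W → V`, easier to apply to walks. Off `T.verts` it takes the
irrelevant value `x`. -/
theorem IsLift.exists_section {T' : G.Subgraph} {T : H.Subgraph} (h : IsLift π T' T) {x : V}
    (hx : x ∈ T'.verts) :
    ∃ l : W → V, l (π x) = x ∧ (∀ w ∈ T.verts, l w ∈ T'.verts ∧ π (l w) = w) ∧
      ∀ a b, T.Adj a b → G.Adj (l a) (l b) := by
  classical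
  obtain ⟨-, φ, hφ⟩ := h
  refine ⟨fun w => if h : w ∈ T.verts then (φ.symm ⟨w, h⟩ : V) else x, ?_, fun w hw => ?_,
    fun a b hab => ?_⟩
  · have h1 : (φ ⟨x, hx⟩ : W) = π x := hφ ⟨x, hx⟩
    have h2 : π x ∈ T.verts := h1 ▸ (φ ⟨x, hx⟩).2
    have h3 : φ.symm ⟨π x, h2⟩ = ⟨x, hx⟩ := by
      rw [RelIso.symm_apply_eq]
      exact Subtype.ext h1.symm
    simp [h2, h3]
  · simp only [hw, dif_pos]
    refine ⟨(φ.symm ⟨w, hw⟩).2, ?_⟩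
    rw [← hφ, RelIso.apply_symm_apply]
  · have ha := T.edge_vert hab
    have hb := T.edge_vert hab.symm
    simp only [ha, hb, dif_pos]
    have : T.coe.Adj ⟨a, ha⟩ ⟨b, hb⟩ := hab
    exact T'.adj_sub (φ.symm.map_rel_iff.2 this)

/-- The tree-lifting hypothesis enters the proof only here, and only for finite paths. -/
theorem exists_disjoint_path_lifts (hlift : HasDisjointTreeLifting G H π) {u v : W}
    {p : H.Walk u v} (hp : p.IsPath) {x y : V} (hxy : x ≠ y) (hx : π x = u) (hy : π y = u) :
    ∃ l₁ l₂ : W → V, (l₁ u = x ∧ l₂ u = y) ∧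
      (∀ w ∈ p.support, π (l₁ w) = w ∧ π (l₂ w) = w ∧ l₁ w ≠ l₂ w) ∧
      ∀ a b, s(a, b) ∈ p.edges → G.Adj (l₁ a) (l₁ b) ∧ G.Adj (l₂ a) (l₂ b) := by
  obtain ⟨T₁, T₂, h₁, h₂, hx₁, hy₂, hd⟩ := hlift p.toSubgraph (isTree_coe_toSubgraph hp) x y hxy
    (hx.trans hy.symm) (by rw [hx]; exact p.start_mem_verts_toSubgraph)
  obtain ⟨l₁, ha₁, hb₁, hc₁⟩ := h₁.exists_section hx₁
  obtain ⟨l₂, ha₂, hb₂, hc₂⟩ := h₂.exists_section hy₂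
  refine ⟨l₁, l₂, ⟨hx ▸ ha₁, hy ▸ ha₂⟩, fun w hw => ?_, fun a b hab => ?_⟩
  · have hw' := p.mem_verts_toSubgraph.2 hw
    exact ⟨(hb₁ w hw').2, (hb₂ w hw').2, fun h =>
      Set.disjoint_left.1 hd (hb₁ w hw').1 (h ▸ (hb₂ w hw').1)⟩
  · have hab' : p.toSubgraph.Adj a b := by
      rwa [← SimpleGraph.Subgraph.mem_edgeSet, SimpleGraph.Walk.mem_edges_toSubgraph]
    exact ⟨hc₁ a b hab', hc₂ a b hab'⟩

theorem openSubgraph_adj {S : Set (Sym2 V)} {x y : V} :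
    (openSubgraph G S).Adj x y ↔ s(x, y) ∈ S ∧ G.Adj x y := by
  simp only [openSubgraph, SimpleGraph.fromEdgeSet_adj, Set.mem_inter_iff,
    SimpleGraph.mem_edgeSet]
  exact ⟨fun h => h.1, fun h => ⟨h, h.2.ne⟩⟩

theorem openSubgraph_mono (G : SimpleGraph V) {S S' : Set (Sym2 V)} (h : S ⊆ S') :
    openSubgraph G S ≤ openSubgraph G S' := fun x y hxy => by
  rw [openSubgraph_adj] at hxy ⊢
  exact ⟨h hxy.1, hxy.2⟩

theorem reachable_map_of_walk {K : SimpleGraph W} {L : SimpleGraph V} (l : W → V) {a b : W}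
    (p : K.Walk a b) (h : ∀ x y, s(x, y) ∈ p.edges → L.Adj (l x) (l y)) :
    L.Reachable (l a) (l b) := by
  induction p with
  | nil => exact .rfl
  | cons hadj p ih =>
    exact (h _ _ (by simp)).reachable.trans (ih fun x y hxy => h x y (by simp [hxy]))

theorem IsWeakCovering.eq_or_adj (hH : H.Connected) (hπ : IsWeakCovering G H π) {x y : V}
    (h : G.Adj x y) : π x = π y ∨ H.Adj (π x) (π y) := by
  have h1 := hπ.dist_le x y
  rw [SimpleGraph.dist_eq_one_iff_adj.2 h] at h1
  rcases Nat.le_one_iff_eq_zero_or_eq_one.1 h1 with h2 | h2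
  · exact Or.inl (hH.dist_eq_zero_iff.1 h2)
  · exact Or.inr (SimpleGraph.dist_eq_one_iff_adj.1 h2)

/-- Around the lift `x` of the centre `u` of a cell there are boundedly many edges, all of them above
the cell except for one above the edge from `a` to `b`, that connect `x` to a lift of `b`. The
exceptional edge avoids a prescribed vertex `z`. -/
theorem exists_connecting_edges (hG : G.Connected) (hπ : IsWeakCovering G H π)
    (hlift : HasDisjointTreeLifting G H π) {R D : ℕ} {c : W → W} (hc : IsCellMap H c R D)
    (htame : ∀ x, ∃ y, π x = π y ∧ 0 < G.dist x y ∧ G.dist x y ≤ R)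
    {u a b : W} (hu : c u = u) (ha : c a = u) (hb : c b ≠ u) (hab : H.Adj a b) {x : V}
    (hx : π x = u) (z : V) :
    ∃ Z : Finset (Sym2 V), (Z : Set (Sym2 V)) ⊆ G.edgeSet ∧ Z.card ≤ R + (D + 1) ∧
      (∃ y, π y = b ∧ (openSubgraph G Z).Reachable x y) ∧
      ∀ e ∈ Z, ∃ v w, e = s(v, w) ∧ c (π v) = u ∧ (c (π w) = u ∨ π v = a ∧ v ≠ z ∧ π w = b) := by
  classical
  obtain ⟨y, hxy, hpos, hle⟩ := htame x
  have hne : x ≠ y := by rintro rfl; simp at hpos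
  obtain ⟨q, hq⟩ := hG.exists_walk_length_eq_dist x y
  -- Since `π` is `1`-Lipschitz, a geodesic from `x` to `y` projects into the ball of radius `R`
  -- about `u`, hence into the cell.
  have hqs : ∀ v ∈ q.support, c (π v) = u := by
    intro v hv
    refine hc.ball u _ hu ?_
    rw [← hx]
    refine (hπ.dist_le x v).trans ((SimpleGraph.dist_le (q.takeUntil v hv)).trans ?_)
    exact (q.length_takeUntil_le_length hv).trans (hq ▸ hle)
  obtain ⟨p₀, hp₀, hp₀l, hp₀s⟩ := hc.exists_path a
  obtain ⟨p, hp, hpl, hps⟩ : ∃ p : H.Walk u a, p.IsPath ∧ p.length ≤ D ∧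
      ∀ v ∈ p.support, c v = u := by
    subst ha
    exact ⟨p₀, hp₀, hp₀l, hp₀s⟩
  have hbp : b ∉ p.support := fun h => hb (hps b h)
  have hp' : (p.concat hab).IsPath := hp.concat hbp hab
  obtain ⟨l₁, l₂, ⟨h₁u, h₂u⟩, hl, hadj⟩ :=
    exists_disjoint_path_lifts hlift hp' hne hx (hxy ▸ hx)
  have hsupp : ∀ w, w ∈ (p.concat hab).support ↔ w ∈ p.support ∨ w = b := by
    intro w; simp [SimpleGraph.Walk.support_concat]
  have haS : a ∈ (p.concat hab).support := (hsupp a).2 (Or.inl p.end_mem_support)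
  -- The two lifts differ above `a`, so at least one avoids `z`. If it is the lift from `y`, the
  -- geodesic `q` joins it to `x`.
  obtain ⟨l, hlu, hla, hlπ, hladj⟩ : ∃ l : W → V, (l u = x ∨ l u = y) ∧ l a ≠ z ∧
      (∀ w ∈ (p.concat hab).support, π (l w) = w) ∧
      ∀ a' b', s(a', b') ∈ (p.concat hab).edges → G.Adj (l a') (l b') := by
    by_cases h : l₁ a = z
    · exact ⟨l₂, Or.inr h₂u, fun h' => (hl a haS).2.2 (h.trans h'.symm),
        fun w hw => (hl w hw).2.1, fun a' b' h => (hadj a' b' h).2⟩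
    · exact ⟨l₁, Or.inl h₁u, h, fun w hw => (hl w hw).1, fun a' b' h => (hadj a' b' h).1⟩
  set Z : Finset (Sym2 V) := q.edges.toFinset ∪ ((p.concat hab).edges.map (Sym2.map l)).toFinset
    with hZ
  have hZq : ∀ e ∈ q.edges, e ∈ Z := fun e he => by simp [hZ, he]
  have hZp : ∀ v w, s(v, w) ∈ (p.concat hab).edges → s(l v, l w) ∈ Z := fun v w h => by
    rw [hZ, Finset.mem_union, List.mem_toFinset, List.mem_toFinset]
    exact Or.inr (List.mem_map.2 ⟨s(v, w), h, rfl⟩)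
  refine ⟨Z, ?_, ?_, ⟨l b, hlπ b ((hsupp b).2 (Or.inr rfl)), ?_⟩, ?_⟩
  · intro e he
    rw [hZ, Finset.mem_coe, Finset.mem_union, List.mem_toFinset, List.mem_toFinset,
      List.mem_map] at he
    rcases he with he | ⟨e', he', rfl⟩
    · exact q.edges_subset_edgeSet he
    · induction e' with
      | _ v w => exact hladj v w he'
  · refine (Finset.card_union_le _ _).trans (add_le_add ?_ ?_)
    · refine (List.toFinset_card_le _).trans ?_
      rw [SimpleGraph.Walk.length_edges, hq]
      exact hle
    · refine (List.toFinset_card_le _).trans ?_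
      rw [List.length_map, SimpleGraph.Walk.length_edges, SimpleGraph.Walk.length_concat]
      omega
  · have hxy' : (openSubgraph G Z).Reachable x y :=
      reachable_map_of_walk id q fun v w h =>
        openSubgraph_adj.2 ⟨hZq _ h, q.adj_of_mem_edges h⟩
    have hub : (openSubgraph G Z).Reachable (l u) (l b) :=
      reachable_map_of_walk l (p.concat hab) fun v w h =>
        openSubgraph_adj.2 ⟨hZp v w h, hladj v w h⟩
    rcases hlu with h | h
    · rwa [h] at hub
    · rw [h] at hub
      exact hxy'.trans hub
  · intro e he
    rw [hZ, Finset.mem_union, List.mem_toFinset, List.mem_toFinset, List.mem_map] at he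
    rcases he with he | ⟨e', he', rfl⟩
    · induction e with
      | _ v w =>
        exact ⟨v, w, rfl, hqs v (q.fst_mem_support_of_mem_edges he),
          Or.inl (hqs w (q.snd_mem_support_of_mem_edges he))⟩
    · rw [SimpleGraph.Walk.edges_concat, List.concat_eq_append, List.mem_append,
        List.mem_singleton] at he'
      rcases he' with he' | rfl
      · induction e' with
        | _ v w =>
          have hv := p.fst_mem_support_of_mem_edges he'
          have hw := p.snd_mem_support_of_mem_edges he'
          refine ⟨l v, l w, rfl, ?_, Or.inl ?_⟩
          · rw [hlπ v ((hsupp v).2 (Or.inl hv))]; exact hps v hv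
          · rw [hlπ w ((hsupp w).2 (Or.inl hw))]; exact hps w hw
      · refine ⟨l a, l b, rfl, ?_, Or.inr ⟨hlπ a haS, hla, hlπ b ((hsupp b).2 (Or.inr rfl))⟩⟩
        rw [hlπ a haS, ha]

end Lifting

/-! ### Lifting the exploration of the enhanced cluster -/

section Coupling

variable {V W : Type*}

/-- The cluster of `v` contains a vertex lying above `T`. -/
def ClusterHits (G : SimpleGraph V) (π : V → W) (v : V) (T : Set W) (S : Set (Sym2 V)) : Prop :=
  ∃ y, π y ∈ T ∧ (openSubgraph G S).Reachable v y

variable {G : SimpleGraph V} {H : SimpleGraph W} {π : V → W} {c : W → W} {o : W} {v₀ : V}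
  {T : Set W} {F : Finset (Sym2 W ⊕ W)} {R D : ℕ} {p s r r₀ r₁ : ℝ}

theorem ClusterHits.mono {S S' : Set (Sym2 V)} (h : S ⊆ S') (hS : ClusterHits G π v₀ T S) :
    ClusterHits G π v₀ T S' :=
  let ⟨y, hy, hr⟩ := hS
  ⟨y, hy, hr.mono (openSubgraph_mono G h)⟩

open Classical in
theorem monotone_indicator_clusterHits (G : SimpleGraph V) (π : V → W) (v₀ : V) (T : Set W)
    (O : Finset (Sym2 V)) :
    Monotone (fun Y : Finset (Sym2 V) =>
      if ClusterHits G π v₀ T ((O ∪ Y : Finset _) : Set (Sym2 V)) then (1 : ℝ) else 0) := by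
  intro S S' h
  by_cases h1 : ClusterHits G π v₀ T ((O ∪ S : Finset _) : Set (Sym2 V))
  · have h2 : ClusterHits G π v₀ T ((O ∪ S' : Finset _) : Set (Sym2 V)) :=
      h1.mono (Finset.coe_subset.2 (Finset.union_subset_union_right h))
    simp only [h1, h2, if_true, le_refl]
  · simp only [h1, if_false]
    split_ifs <;> norm_num

open Classical in
/-- Given that the edges in `O` are open and those in `C` are closed, the cluster of `v` meets
`π ⁻¹' T` with probability at least `r`, by virtue of finitely many further edges. -/
def CondHitGE (G : SimpleGraph V) (π : V → W) (v : V) (T : Set W) (p : ℝ) (O C : Finset (Sym2 V))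
    (r : ℝ) : Prop :=
  ∃ E : Finset (Sym2 V), (E : Set (Sym2 V)) ⊆ G.edgeSet ∧ (∀ e ∈ E, e ∉ O ∧ e ∉ C) ∧
    r ≤ bernoulliExp (fun _ => p) E
      (fun Y => if ClusterHits G π v T ((O ∪ Y : Finset _) : Set (Sym2 V)) then 1 else 0)

theorem CondHitGE.mono {O C : Finset (Sym2 V)} (h : CondHitGE G π v₀ T p O C r) (hr : r₀ ≤ r) :
    CondHitGE G π v₀ T p O C r₀ :=
  let ⟨E, h1, h2, h3⟩ := h
  ⟨E, h1, h2, hr.trans h3⟩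

theorem condHitGE_zero {O C : Finset (Sym2 V)} : CondHitGE G π v₀ T p O C 0 :=
  ⟨∅, by simp, by simp, by simp only [bernoulliExp_empty]; split_ifs <;> norm_num⟩

theorem condHitGE_one {O C : Finset (Sym2 V)} (h : ClusterHits G π v₀ T (O : Set (Sym2 V))) :
    CondHitGE G π v₀ T p O C 1 :=
  ⟨∅, by simp, by simp, by simp [h]⟩

open Classical in
/-- Revealing the state of an edge. -/
theorem CondHitGE.reveal (hp : p ∈ Set.Icc (0 : ℝ) 1)
    {O C : Finset (Sym2 V)} {e : Sym2 V}
    (he : e ∈ G.edgeSet) (heO : e ∉ O) (heC : e ∉ C)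
    (h₁ : CondHitGE G π v₀ T p (insert e O) C r₁) (h₀ : CondHitGE G π v₀ T p O (insert e C) r₀) :
    CondHitGE G π v₀ T p O C (p * r₁ + (1 - p) * r₀) := by
  obtain ⟨E₁, hE₁, hd₁, hr₁⟩ := h₁
  obtain ⟨E₀, hE₀, hd₀, hr₀⟩ := h₀
  have heE : e ∉ E₁ ∪ E₀ := by
    rw [Finset.mem_union]
    rintro (h | h)
    · exact (hd₁ e h).1 (Finset.mem_insert_self e O)
    · exact (hd₀ e h).2 (Finset.mem_insert_self e C)
  refine ⟨insert e (E₁ ∪ E₀), ?_, ?_, ?_⟩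
  · rw [Finset.coe_insert, Finset.coe_union]
    exact Set.insert_subset he (Set.union_subset hE₁ hE₀)
  · intro e' he'
    rw [Finset.mem_insert, Finset.mem_union] at he'
    rcases he' with rfl | h | h
    · exact ⟨heO, heC⟩
    · exact ⟨fun h' => (hd₁ e' h).1 (Finset.mem_insert_of_mem h'), (hd₁ e' h).2⟩
    · exact ⟨(hd₀ e' h).1, fun h' => (hd₀ e' h).2 (Finset.mem_insert_of_mem h')⟩
  · rw [bernoulliExp_insert _ _ heE]
    have hp' : ∀ i : Sym2 V, (fun _ : Sym2 V => p) i ∈ Set.Icc (0 : ℝ) 1 := fun _ => hp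
    refine add_le_add (mul_le_mul_of_nonneg_left ?_ hp.1)
      (mul_le_mul_of_nonneg_left ?_ (sub_nonneg.2 hp.2))
    · refine hr₁.trans ((bernoulliExp_mono_finset hp' (monotone_indicator_clusterHits _ _ _ _ _)
        (Finset.subset_union_left (s₂ := E₀))).trans (le_of_eq ?_))
      refine bernoulliExp_congr_right _ fun S _ => ?_
      have : insert e O ∪ S = O ∪ insert e S := by
        ext i; simp only [Finset.mem_union, Finset.mem_insert]; tauto
      rw [← this]
    · exact hr₀.trans (bernoulliExp_mono_finset hp' (monotone_indicator_clusterHits _ _ _ _ _)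
        Finset.subset_union_right)

open Classical in
/-- Revealing the states of several edges, until one of them turns out to be closed. -/
theorem CondHitGE.reveal_finset (hp : p ∈ Set.Icc (0 : ℝ) 1)
    (Z : Finset (Sym2 V)) {O C : Finset (Sym2 V)} (hr : r₀ ≤ r₁)
    (hZ : (Z : Set (Sym2 V)) ⊆ G.edgeSet) (hZC : ∀ e ∈ Z, e ∉ C)
    (h₁ : CondHitGE G π v₀ T p (O ∪ Z) C r₁)
    (h₀ : ∀ O', O ⊆ O' → O' ⊆ O ∪ Z → ∀ z ∈ Z, CondHitGE G π v₀ T p O' (insert z C) r₀) :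
    CondHitGE G π v₀ T p O C (p ^ Z.card * r₁ + (1 - p ^ Z.card) * r₀) := by
  induction Z using Finset.induction_on generalizing O with
  | empty => simpa using h₁
  | insert z Z hz ih =>
    rw [Finset.coe_insert, Set.insert_subset_iff] at hZ
    rw [Finset.card_insert_of_notMem hz, pow_succ']
    have hpow0 : 0 ≤ p ^ Z.card := pow_nonneg hp.1 _
    have hpow1 : p ^ Z.card ≤ 1 := pow_le_one₀ hp.1 hp.2
    by_cases hzO : z ∈ O
    -- An edge already known to be open needs no revealing; the extra factor `p` only weakens the
    -- bound, because `r₀ ≤ r₁`.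
    · have e : O ∪ insert z Z = O ∪ Z := by
        ext i; simp only [Finset.mem_union, Finset.mem_insert]; grind
      rw [e] at h₁ h₀
      refine (ih hZ.2 (fun e he => hZC e (Finset.mem_insert_of_mem he)) h₁
        fun O' h1 h2 z' hz' => h₀ O' h1 h2 z' (Finset.mem_insert_of_mem hz')).mono ?_
      nlinarith [hp.2, mul_nonneg hpow0 (sub_nonneg.2 hr)]
    · have e : insert z O ∪ Z = O ∪ insert z Z := by
        ext i; simp only [Finset.mem_union, Finset.mem_insert]; tauto
      have hopen := ih (O := insert z O) hZ.2
        (fun e he => hZC e (Finset.mem_insert_of_mem he)) (by rwa [e]) fun O' h1 h2 z' hz' =>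
          h₀ O' ((Finset.subset_insert z O).trans h1) (e ▸ h2) z' (Finset.mem_insert_of_mem hz')
      have hclosed := h₀ O subset_rfl Finset.subset_union_left z (Finset.mem_insert_self z Z)
      refine (CondHitGE.reveal hp hZ.1 hzO (hZC z (Finset.mem_insert_self z Z)) hopen
        hclosed).mono (le_of_eq ?_)
      ring

open Classical in
/-- The conditional probability that the enhanced cluster meets `T`, given that the bits in `O` are
on and those in `C` are off. -/
noncomputable def condEnhProb (H : SimpleGraph W) (c : W → W) (o : W) (T : Set W)
    (F : Finset (Sym2 W ⊕ W)) (p s : ℝ) (O C : Finset (Sym2 W ⊕ W)) : ℝ :=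
  bernoulliExp (enhParam W p s) (F \ (O ∪ C)) (fun S =>
    if EnhHits H c o T ((O ∪ S : Finset _) : Set (Sym2 W ⊕ W)) then 1 else 0)

-- The counterpart in `H` of `CondHitGE.reveal`; the induction on the exploration matches the two
-- recursions.
open Classical in
theorem condEnhProb_split {O C : Finset (Sym2 W ⊕ W)}
    {i : Sym2 W ⊕ W} (hi : i ∈ F \ (O ∪ C)) :
    condEnhProb H c o T F p s O C = enhParam W p s i * condEnhProb H c o T F p s (insert i O) C +
      (1 - enhParam W p s i) * condEnhProb H c o T F p s O (insert i C) := by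
  have e0 : F \ (O ∪ C) = insert i (F \ (insert i O ∪ C)) := by
    ext j; simp only [Finset.mem_sdiff, Finset.mem_union, Finset.mem_insert] at hi ⊢; grind
  have e1 : F \ (O ∪ insert i C) = F \ (insert i O ∪ C) := by
    ext j; simp only [Finset.mem_sdiff, Finset.mem_union, Finset.mem_insert] at hi ⊢; grind
  have hi' : i ∉ F \ (insert i O ∪ C) := by simp
  have e2 : ∀ S : Finset (Sym2 W ⊕ W), O ∪ insert i S = insert i O ∪ S := fun S => by
    ext j; simp only [Finset.mem_union, Finset.mem_insert]; tauto
  unfold condEnhProb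
  have e0' : bernoulliExp (enhParam W p s) (F \ (O ∪ C)) (fun S =>
      if EnhHits H c o T ((O ∪ S : Finset _) : Set (Sym2 W ⊕ W)) then (1 : ℝ) else 0) =
      bernoulliExp (enhParam W p s) (insert i (F \ (insert i O ∪ C))) (fun S =>
      if EnhHits H c o T ((O ∪ S : Finset _) : Set (Sym2 W ⊕ W)) then 1 else 0) := by
    rw [← e0]
  have e1' : bernoulliExp (enhParam W p s) (F \ (O ∪ insert i C)) (fun S =>
      if EnhHits H c o T ((O ∪ S : Finset _) : Set (Sym2 W ⊕ W)) then (1 : ℝ) else 0) =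
      bernoulliExp (enhParam W p s) (F \ (insert i O ∪ C)) (fun S =>
      if EnhHits H c o T ((O ∪ S : Finset _) : Set (Sym2 W ⊕ W)) then 1 else 0) := by
    rw [← e1]
  have e2' : (fun S : Finset (Sym2 W ⊕ W) =>
      if EnhHits H c o T ((O ∪ insert i S : Finset _) : Set (Sym2 W ⊕ W)) then (1 : ℝ) else 0) =
      fun S => if EnhHits H c o T ((insert i O ∪ S : Finset _) : Set (Sym2 W ⊕ W)) then 1 else 0 :=
    funext fun S => by rw [e2]
  rw [e0', bernoulliExp_insert _ _ hi', e2', e1']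

end Coupling

/-! ### Invariants of the lifted exploration. -/

section Exploration

variable {V W : Type*}

/-- A stage of the exploration of the enhanced cluster of `o` in `H`, lifted to the cluster of `v₀`
in `G`. The bits in `O` are known to be on and those in `C` to be off; the edges in `O'` are known
to be open and those in `C'` to be closed; the set `A` of reached vertices is lifted by `l` to the
cluster of `v₀`. -/
structure IsExploration (G : SimpleGraph V) (H : SimpleGraph W) (π : V → W) (c : W → W) (o : W)
    (v₀ : V) (F O C : Finset (Sym2 W ⊕ W)) (O' C' : Finset (Sym2 V)) (A : Set W) (l : W → V) :
    Prop where
  off_subset : C ⊆ F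
  disjoint : Disjoint O C
  base : o ∈ A
  edge : ∀ x y, Sum.inl s(x, y) ∈ O → x ∈ A ∧ y ∈ A
  centre : ∀ u, Sum.inr u ∈ O → ∀ x y, c x = u → H.Adj x y → y ∈ A
  lift : ∀ a ∈ A, π (l a) = a
  reachable : ∀ a ∈ A, (openSubgraph G (O' : Set (Sym2 V))).Reachable v₀ (l a)
  explored : ∀ e, e ∈ O' ∨ e ∈ C' →
    (e.map π).IsDiag ∨ Sum.inl (e.map π) ∈ O ∨ Sum.inl (e.map π) ∈ C
  -- A closed edge was met either at the chosen lift of a reached vertex, its image being off, or in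
  -- a failed attempt at an activity, above a cell that is entirely reached. This record shows that
  -- later attempts meet no closed edge.
  closed : ∀ e ∈ C', (∃ a ∈ A, ∃ y, e = s(l a, y) ∧ Sum.inl s(a, π y) ∈ C) ∨
    ∃ x y, e = s(x, y) ∧ Sum.inr (c (π x)) ∈ C ∧ ∀ w, c w = c (π x) → w ∈ A

variable {G : SimpleGraph V} {H : SimpleGraph W} {π : V → W} {c : W → W} {o : W} {v₀ : V}
  {T : Set W} {F O C : Finset (Sym2 W ⊕ W)} {O' C' : Finset (Sym2 V)} {A : Set W} {l : W → V}
  {R D B : ℕ} {p s : ℝ}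

-- A vertex reached earlier keeps its lift, since `closed` refers to the lifts chosen so far.
open Classical in
theorem IsExploration.edge_open (h : IsExploration G H π c o v₀ F O C O' C' A l) {a b : W} {y : V}
    (ha : a ∈ A) (hy : π y = b) (hadj : G.Adj (l a) y) (he : Sum.inl s(a, b) ∉ C) :
    IsExploration G H π c o v₀ F (insert (Sum.inl s(a, b)) O) C (insert s(l a, y) O') C'
      (insert b A) (fun w => if w ∈ A then l w else y) where
  off_subset := h.off_subset
  disjoint := Finset.disjoint_insert_left.2 ⟨he, h.disjoint⟩
  base := Or.inr h.base
  edge := by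
    intro x z hxz
    rw [Finset.mem_insert, Sum.inl.injEq, Sym2.eq_iff] at hxz
    rcases hxz with (⟨rfl, rfl⟩ | ⟨rfl, rfl⟩) | hxz
    · exact ⟨Or.inr ha, Or.inl rfl⟩
    · exact ⟨Or.inl rfl, Or.inr ha⟩
    · exact ⟨Or.inr (h.edge x z hxz).1, Or.inr (h.edge x z hxz).2⟩
  centre := by
    intro u hu x z hx hxz
    rw [Finset.mem_insert] at hu
    rcases hu with hu | hu
    · cases hu
    · exact Or.inr (h.centre u hu x z hx hxz)
  lift := by
    intro w hw
    by_cases hwA : w ∈ A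
    · simpa [hwA] using h.lift w hwA
    · rw [Set.mem_insert_iff] at hw
      simp only [hwA, if_false]
      rw [hy, hw.resolve_right hwA]
  reachable := by
    have hmono : openSubgraph G (O' : Set (Sym2 V)) ≤
        openSubgraph G ((insert s(l a, y) O' : Finset _) : Set (Sym2 V)) :=
      openSubgraph_mono G (Finset.coe_subset.2 (Finset.subset_insert _ _))
    intro w hw
    by_cases hwA : w ∈ A
    · simpa only [hwA, if_true] using (h.reachable w hwA).mono hmono
    · simp only [hwA, if_false]
      refine ((h.reachable a ha).mono hmono).trans (SimpleGraph.Adj.reachable ?_)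
      exact openSubgraph_adj.2 ⟨by simp, hadj⟩
  explored := by
    intro e he'
    rw [Finset.mem_insert] at he'
    rcases he' with (rfl | he') | he'
    · rw [Sym2.map_mk, h.lift a ha, hy]
      exact Or.inr (Or.inl (Finset.mem_insert_self _ _))
    · exact (h.explored e (Or.inl he')).imp_right (Or.imp_left Finset.mem_insert_of_mem)
    · exact (h.explored e (Or.inr he')).imp_right (Or.imp_left Finset.mem_insert_of_mem)
  closed := by
    intro e he'
    rcases h.closed e he' with ⟨a', ha', y', rfl, hC⟩ | ⟨x, z, rfl, hC, hA⟩
    · exact Or.inl ⟨a', Or.inr ha', y', by simp [ha'], hC⟩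
    · exact Or.inr ⟨x, z, rfl, hC, fun w hw => Or.inr (hA w hw)⟩

open Classical in
theorem IsExploration.edge_closed (h : IsExploration G H π c o v₀ F O C O' C' A l) {a b : W} {y : V}
    (ha : a ∈ A) (hy : π y = b) (heF : Sum.inl s(a, b) ∈ F) (he : Sum.inl s(a, b) ∉ O) :
    IsExploration G H π c o v₀ F O (insert (Sum.inl s(a, b)) C) O' (insert s(l a, y) C') A l where
  off_subset := Finset.insert_subset heF h.off_subset
  disjoint := Finset.disjoint_insert_right.2 ⟨he, h.disjoint⟩
  base := h.base
  edge := h.edge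
  centre := h.centre
  lift := h.lift
  reachable := h.reachable
  explored := by
    intro e he'
    rw [Finset.mem_insert] at he'
    rcases he' with he' | rfl | he'
    · exact (h.explored e (Or.inl he')).imp_right (Or.imp_right Finset.mem_insert_of_mem)
    · rw [Sym2.map_mk, h.lift a ha, hy]
      exact Or.inr (Or.inr (Finset.mem_insert_self _ _))
    · exact (h.explored e (Or.inr he')).imp_right (Or.imp_right Finset.mem_insert_of_mem)
  closed := by
    intro e he'
    rw [Finset.mem_insert] at he'
    rcases he' with rfl | he'
    · exact Or.inl ⟨a, ha, y, rfl, by rw [hy]; exact Finset.mem_insert_self _ _⟩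
    · rcases h.closed e he' with ⟨a', ha', y', rfl, hC⟩ | ⟨x, z, rfl, hC, hA⟩
      · exact Or.inl ⟨a', ha', y', rfl, Finset.mem_insert_of_mem hC⟩
      · exact Or.inr ⟨x, z, rfl, Finset.mem_insert_of_mem hC, hA⟩

-- The edges of `Z` are revealed until the first closed one, `z`; `O''` records those found open
-- before that.
open Classical in
theorem IsExploration.centre_inactive (h : IsExploration G H π c o v₀ F O C O' C' A l) {u : W}
    (hu : Sum.inr u ∈ F) (huO : Sum.inr u ∉ O) (hA : ∀ w, c w = u → w ∈ A)
    {Z O'' : Finset (Sym2 V)} (hO : O' ⊆ O'') (hOZ : O'' ⊆ O' ∪ Z)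
    (hZ : ∀ e ∈ Z, (e.map π).IsDiag ∨ Sum.inl (e.map π) ∈ O ∨ Sum.inl (e.map π) ∈ C)
    (hZu : ∀ e ∈ Z, ∃ v w, e = s(v, w) ∧ c (π v) = u) {z : Sym2 V} (hz : z ∈ Z) :
    IsExploration G H π c o v₀ F O (insert (Sum.inr u) C) O'' (insert z C') A l where
  off_subset := Finset.insert_subset hu h.off_subset
  disjoint := Finset.disjoint_insert_right.2 ⟨huO, h.disjoint⟩
  base := h.base
  edge := h.edge
  centre := h.centre
  lift := h.lift
  reachable := fun a ha =>
    (h.reachable a ha).mono (openSubgraph_mono G (Finset.coe_subset.2 hO))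
  explored := by
    have key : ∀ e, (e ∈ O' ∨ e ∈ C') ∨ e ∈ Z →
        (e.map π).IsDiag ∨ Sum.inl (e.map π) ∈ O ∨ Sum.inl (e.map π) ∈ insert (Sum.inr u) C := by
      rintro e (he | he)
      · exact (h.explored e he).imp_right (Or.imp_right Finset.mem_insert_of_mem)
      · exact (hZ e he).imp_right (Or.imp_right Finset.mem_insert_of_mem)
    intro e he'
    rw [Finset.mem_insert] at he'
    rcases he' with he' | rfl | he'
    · rcases Finset.mem_union.1 (hOZ he') with h' | h'
      · exact key e (Or.inl (Or.inl h'))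
      · exact key e (Or.inr h')
    · exact key e (Or.inr hz)
    · exact key e (Or.inl (Or.inr he'))
  closed := by
    intro e he'
    rw [Finset.mem_insert] at he'
    rcases he' with rfl | he'
    · obtain ⟨v, w, rfl, hv⟩ := hZu e hz
      exact Or.inr ⟨v, w, rfl, by rw [hv]; exact Finset.mem_insert_self _ _, by rwa [hv]⟩
    · rcases h.closed e he' with ⟨a', ha', y', rfl, hC⟩ | ⟨x, z, rfl, hC, hA⟩
      · exact Or.inl ⟨a', ha', y', rfl, Finset.mem_insert_of_mem hC⟩
      · exact Or.inr ⟨x, z, rfl, Finset.mem_insert_of_mem hC, hA⟩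

-- All edges of `Z` are open, so the new neighbours of the cell acquire the lifts `τ`.
open Classical in
theorem IsExploration.centre_active (h : IsExploration G H π c o v₀ F O C O' C' A l) {u : W}
    (huC : Sum.inr u ∉ C) (hA : ∀ w, c w = u → w ∈ A) {x : V}
    (hx : (openSubgraph G (O' : Set (Sym2 V))).Reachable v₀ x) {Z : Finset (Sym2 V)}
    (hZ : ∀ e ∈ Z, (e.map π).IsDiag ∨ Sum.inl (e.map π) ∈ O ∨ Sum.inl (e.map π) ∈ C) {τ : W → V}
    {E : Set W} (hE : ∀ x y, c x = u → H.Adj x y → y ∉ A → y ∈ E)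
    (hτ : ∀ b ∈ E, π (τ b) = b ∧ (openSubgraph G (Z : Set (Sym2 V))).Reachable x (τ b)) :
    IsExploration G H π c o v₀ F (insert (Sum.inr u) O) C (O' ∪ Z) C' (A ∪ E)
      (fun w => if w ∈ A then l w else τ w) where
  off_subset := h.off_subset
  disjoint := Finset.disjoint_insert_left.2 ⟨huC, h.disjoint⟩
  base := Or.inl h.base
  edge := by
    intro x z hxz
    rw [Finset.mem_insert] at hxz
    rcases hxz with hxz | hxz
    · cases hxz
    · exact ⟨Or.inl (h.edge x z hxz).1, Or.inl (h.edge x z hxz).2⟩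
  centre := by
    intro u' hu x z hx hxz
    by_cases hzA : z ∈ A
    · exact Or.inl hzA
    rw [Finset.mem_insert] at hu
    rcases hu with hu | hu
    · rw [Sum.inr.injEq] at hu
      subst hu
      exact Or.inr (hE x z hx hxz hzA)
    · exact Or.inl (h.centre u' hu x z hx hxz)
  lift := by
    intro w hw
    by_cases hwA : w ∈ A
    · simpa [hwA] using h.lift w hwA
    · simpa [hwA] using (hτ w (hw.resolve_left hwA)).1
  reachable := by
    intro w hw
    by_cases hwA : w ∈ A
    · simpa only [hwA, if_true] using (h.reachable w hwA).mono
        (openSubgraph_mono G (Finset.coe_subset.2 Finset.subset_union_left))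
    · simp only [hwA, if_false]
      exact (hx.mono (openSubgraph_mono G (Finset.coe_subset.2 Finset.subset_union_left))).trans
        ((hτ w (hw.resolve_left hwA)).2.mono
          (openSubgraph_mono G (Finset.coe_subset.2 Finset.subset_union_right)))
  explored := by
    have key : ∀ e, (e ∈ O' ∨ e ∈ C') ∨ e ∈ Z →
        (e.map π).IsDiag ∨ Sum.inl (e.map π) ∈ insert (Sum.inr u) O ∨ Sum.inl (e.map π) ∈ C := by
      rintro e (he | he)
      · exact (h.explored e he).imp_right (Or.imp_left Finset.mem_insert_of_mem)
      · exact (hZ e he).imp_right (Or.imp_left Finset.mem_insert_of_mem)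
    intro e he'
    rw [Finset.mem_union] at he'
    rcases he' with (he' | he') | he'
    · exact key e (Or.inl (Or.inl he'))
    · exact key e (Or.inr he')
    · exact key e (Or.inl (Or.inr he'))
  closed := by
    intro e he'
    rcases h.closed e he' with ⟨a', ha', y', rfl, hC⟩ | ⟨x, z, rfl, hC, hA⟩
    · exact Or.inl ⟨a', Or.inl ha', y', by simp [ha'], hC⟩
    · exact Or.inr ⟨x, z, rfl, hC, fun w hw => Or.inl (hA w hw)⟩

/-- Once the bits attached to the reached vertices have been explored, the enhanced cluster has been
found. -/
theorem IsExploration.mem_of_enhReach (h : IsExploration G H π c o v₀ F O C O' C' A l)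
    {S : Set (Sym2 W ⊕ W)} (hS : ∀ i ∈ S, i ∈ F ∧ i ∉ O ∧ i ∉ C)
    (hedge : ∀ a ∈ A, ∀ b, H.Adj a b → Sum.inl s(a, b) ∈ F →
      Sum.inl s(a, b) ∈ O ∨ Sum.inl s(a, b) ∈ C)
    (hcentre : ∀ u, Sum.inr u ∈ F → (∀ w, c w = u → w ∈ A) →
      (∀ a b, H.Adj a b → c a = u → c b = u → Sum.inl s(a, b) ∈ O) →
      Sum.inr u ∈ O ∨ Sum.inr u ∈ C) {w : W} (hw : EnhReach H c o (O ∪ S) w) : w ∈ A := by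
  have hedge' : ∀ a b, a ∈ A → H.Adj a b → Sum.inl s(a, b) ∈ (O : Set (Sym2 W ⊕ W)) ∪ S →
      Sum.inl s(a, b) ∈ O := by
    rintro a b ha hab (he | he)
    · exact he
    · rcases hedge a ha b hab (hS _ he).1 with h' | h'
      · exact h'
      · exact absurd h' (hS _ he).2.2
  induction hw with
  | base => exact h.base
  | edge _ hadj he ih => exact (h.edge _ _ (hedge' _ _ ih hadj he)).2
  | enh hu _ ho hx hadj ih =>
    rcases hu with hu | hu
    · exact h.centre _ hu _ _ hx hadj
    · rcases hcentre _ (hS _ hu).1 ih fun a b hab ha hb =>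
        hedge' a b (ih a ha) hab (ho a b hab ha hb) with h' | h'
      · exact absurd h' (hS _ hu).2.1
      · exact absurd h' (hS _ hu).2.2

open Classical in
/-- The edges to be examined in `G` when the activity of a cell is revealed. -/
theorem IsExploration.exists_fresh_edges (hG : G.Connected) (hH : H.Connected)
    (hπ : IsWeakCovering G H π) (hlift : HasDisjointTreeLifting G H π)
    (hc : IsCellMap H c R D)
    (htame : ∀ x, ∃ y, π x = π y ∧ 0 < G.dist x y ∧ G.dist x y ≤ R)
    (hF : IsVolume H c T F)
    (hB : ∀ u, {b | ∃ a, c a = u ∧ H.Adj a b}.encard ≤ B)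
    (h : IsExploration G H π c o v₀ F O C O' C' A l) (hAT : ∀ w ∈ A, w ∉ T)
    (hedge : ∀ a ∈ A, ∀ b, H.Adj a b → Sum.inl s(a, b) ∈ F →
      Sum.inl s(a, b) ∈ O ∨ Sum.inl s(a, b) ∈ C)
    {u : W} (hu : c u = u) (huC : Sum.inr u ∉ C) (hA : ∀ w, c w = u → w ∈ A)
    (hin : ∀ a b, H.Adj a b → c a = u → c b = u → Sum.inl s(a, b) ∈ O) :
    ∃ (Z : Finset (Sym2 V)) (τ : W → V), (Z : Set (Sym2 V)) ⊆ G.edgeSet ∧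
      Z.card ≤ B * (R + (D + 1)) ∧
      (∀ e ∈ Z, (e.map π).IsDiag ∨ Sum.inl (e.map π) ∈ O ∨ Sum.inl (e.map π) ∈ C) ∧
      (∀ e ∈ Z, ∃ v w, e = s(v, w) ∧ c (π v) = u) ∧ (∀ e ∈ Z, e ∉ C') ∧
      ∀ b, (∃ a, c a = u ∧ H.Adj a b) → b ∉ A →
        π (τ b) = b ∧ (openSubgraph G (Z : Set (Sym2 V))).Reachable (l u) (τ b) := by
  have huA : u ∈ A := hA u hu
  set E : Set W := {b | ∃ a, c a = u ∧ H.Adj a b} with hE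
  have hEfin : E.Finite := Set.finite_of_encard_le_coe (hB u)
  have hkey : ∀ b, ∃ (Z : Finset (Sym2 V)) (y : V), b ∈ E → b ∉ A →
      (Z : Set (Sym2 V)) ⊆ G.edgeSet ∧ Z.card ≤ R + (D + 1) ∧
      (∀ e ∈ Z, (e.map π).IsDiag ∨ Sum.inl (e.map π) ∈ O ∨ Sum.inl (e.map π) ∈ C) ∧
      (∀ e ∈ Z, ∃ v w, e = s(v, w) ∧ c (π v) = u) ∧ (∀ e ∈ Z, e ∉ C') ∧
      π y = b ∧ (openSubgraph G (Z : Set (Sym2 V))).Reachable (l u) y := by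
    intro b
    by_cases hb : b ∈ E ∧ b ∉ A
    swap
    · exact ⟨∅, v₀, fun h1 h2 => absurd ⟨h1, h2⟩ hb⟩
    obtain ⟨⟨a, ha, hab⟩, hbA⟩ := hb
    have hbu : c b ≠ u := fun h' => hbA (hA b h')
    obtain ⟨Z, hZ, hcard, ⟨y, hy, hr⟩, hZe⟩ := exists_connecting_edges hG hπ hlift hc htame hu ha
      hbu hab (h.lift u huA) (l a)
    have habF : Sum.inl s(a, b) ∈ F := (hF.edge _).2 ⟨a, b, hab, hAT a (hA a ha), rfl⟩
    refine ⟨Z, y, fun _ _ => ⟨hZ, hcard, fun e he => ?_, fun e he => ?_, fun e he heC => ?_,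
      hy, hr⟩⟩
    · obtain ⟨v, w, rfl, hv, hw | ⟨rfl, -, rfl⟩⟩ := hZe e he
      · rcases hπ.eq_or_adj hH (hZ he) with h' | h'
        · exact Or.inl (by simpa using h')
        · exact Or.inr (Or.inl (hin _ _ h' hv hw))
      · exact Or.inr (hedge _ (hA _ ha) _ hab habF)
    · obtain ⟨v, w, rfl, hv, -⟩ := hZe e he
      exact ⟨v, w, rfl, hv⟩
    · obtain ⟨v, w, rfl, hv, hw⟩ := hZe e he
      -- If `e` was closed while revealing an edge of `H`, its image is off: an inner edge of the
      -- cell is on, and the exceptional edge contains neither `l a` nor the lift of a reached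
      -- vertex above `b`. If it was closed in a failed attempt, the cell of that attempt is either
      -- that of `u`, which is not off, or that of `b`, which is not entirely reached.
      rcases h.closed _ heC with ⟨a', ha', y', heq, hC⟩ | ⟨x, z, heq, hC, hcA⟩
      · have hmap : s(π v, π w) = s(a', π y') := by
          have := congrArg (Sym2.map π) heq
          simpa [h.lift a' ha'] using this
        rcases hw with hw | ⟨hva, hvz, hwb⟩
        · rw [← hmap] at hC
          obtain ⟨x1, x2, hx12, -, hx⟩ := (hF.edge _).1 (h.off_subset hC)
          have hadj : H.Adj (π v) (π w) := by
            rw [← SimpleGraph.mem_edgeSet, hx]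
            exact hx12
          exact Finset.disjoint_left.1 h.disjoint (hin _ _ hadj hv hw) hC
        · rw [Sym2.eq_iff] at heq
          rcases heq with ⟨h1, h2⟩ | ⟨h1, h2⟩
          · have : a' = a := by rw [← h.lift a' ha', ← h1, hva]
            exact hvz (by rw [h1, this])
          · have : a' = b := by rw [← h.lift a' ha', ← h2, hwb]
            exact hbA (this ▸ ha')
      · rw [Sym2.eq_iff] at heq
        rcases heq with ⟨rfl, rfl⟩ | ⟨rfl, rfl⟩
        · exact huC (hv ▸ hC)
        · rcases hw with hw | ⟨hva, hvz, hwb⟩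
          · exact huC (hw ▸ hC)
          · exact hbA (hcA b (by rw [hwb]))
  choose Z τ hZτ using hkey
  set E' : Finset W := hEfin.toFinset.filter (· ∉ A) with hE'
  have hmemE' : ∀ b, b ∈ E' ↔ b ∈ E ∧ b ∉ A := fun b => by simp [hE']
  have hE'card : E'.card ≤ B := by
    refine (Finset.card_filter_le _ _).trans ?_
    have := hB u
    rw [← hE, hEfin.encard_eq_coe_toFinset_card] at this
    exact_mod_cast this
  refine ⟨E'.biUnion Z, τ, ?_, ?_, ?_, ?_, ?_, ?_⟩
  · intro e he
    obtain ⟨b, hb, he⟩ := Finset.mem_biUnion.1 he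
    exact (hZτ b ((hmemE' b).1 hb).1 ((hmemE' b).1 hb).2).1 he
  · refine (Finset.card_biUnion_le_card_mul _ _ _ fun b hb =>
      (hZτ b ((hmemE' b).1 hb).1 ((hmemE' b).1 hb).2).2.1).trans ?_
    exact Nat.mul_le_mul_right _ hE'card
  · intro e he
    obtain ⟨b, hb, he⟩ := Finset.mem_biUnion.1 he
    exact (hZτ b ((hmemE' b).1 hb).1 ((hmemE' b).1 hb).2).2.2.1 e he
  · intro e he
    obtain ⟨b, hb, he⟩ := Finset.mem_biUnion.1 he
    exact (hZτ b ((hmemE' b).1 hb).1 ((hmemE' b).1 hb).2).2.2.2.1 e he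
  · intro e he
    obtain ⟨b, hb, he⟩ := Finset.mem_biUnion.1 he
    exact (hZτ b ((hmemE' b).1 hb).1 ((hmemE' b).1 hb).2).2.2.2.2.1 e he
  · intro b hbE hbA
    obtain ⟨-, -, -, -, -, h1, h2⟩ := hZτ b hbE hbA
    exact ⟨h1, h2.mono (openSubgraph_mono G (Finset.coe_subset.2
      (Finset.subset_biUnion_of_mem Z ((hmemE' b).2 ⟨hbE, hbA⟩))))⟩

end Exploration

/-! ### The cluster in `G` dominates the enhanced cluster in `H`. -/

section Domination

variable {V W : Type*} {G : SimpleGraph V} {H : SimpleGraph W} {π : V → W} {c : W → W} {o : W}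
  {v₀ : V} {T : Set W} {F O C : Finset (Sym2 W ⊕ W)} {O' C' : Finset (Sym2 V)} {A : Set W}
  {l : W → V} {R D B : ℕ} {p s : ℝ}

theorem condEnhProb_le_one (hp : p ∈ Set.Icc (0 : ℝ) 1) (hs : s ∈ Set.Icc (0 : ℝ) 1) :
    condEnhProb H c o T F p s O C ≤ 1 := by
  unfold condEnhProb
  refine le_trans (bernoulliExp_mono (g := fun _ => 1) (enhParam_mem_Icc hp hs) fun S _ => ?_)
    (le_of_eq (bernoulliExp_const _ _ _))
  split_ifs <;> norm_num

open Classical in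
theorem condEnhProb_insert_le (hp : p ∈ Set.Icc (0 : ℝ) 1) (hs : s ∈ Set.Icc (0 : ℝ) 1)
    (i : Sym2 W ⊕ W) :
    condEnhProb H c o T F p s O (insert i C) ≤ condEnhProb H c o T F p s (insert i O) C := by
  have e : F \ (insert i O ∪ C) = F \ (O ∪ insert i C) := by
    ext j; simp only [Finset.mem_sdiff, Finset.mem_union, Finset.mem_insert]; tauto
  unfold condEnhProb
  rw [e]
  refine bernoulliExp_mono (enhParam_mem_Icc hp hs) fun S _ => ?_
  have hsub : O ∪ S ⊆ insert i O ∪ S :=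
    Finset.union_subset_union_left (Finset.subset_insert i O)
  by_cases h1 : EnhHits H c o T ((O ∪ S : Finset _) : Set (Sym2 W ⊕ W))
  · rw [if_pos h1, if_pos (h1.mono (Finset.coe_subset.2 hsub))]
  · rw [if_neg h1]
    split_ifs <;> norm_num

/-- The exploration of the enhanced cluster in `H` lifts to the cluster in `G`. -/
theorem IsExploration.condHitGE (hG : G.Connected) (hH : H.Connected)
    (hπ : IsWeakCovering G H π) (hlift : HasDisjointTreeLifting G H π)
    (hc : IsCellMap H c R D)
    (htame : ∀ x, ∃ y, π x = π y ∧ 0 < G.dist x y ∧ G.dist x y ≤ R)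
    (hF : IsVolume H c T F)
    (hB : ∀ u, {b | ∃ a, c a = u ∧ H.Adj a b}.encard ≤ B)
    (hp : p ∈ Set.Icc (0 : ℝ) 1) (hs : s ∈ Set.Icc (0 : ℝ) 1)
    (hsp : s ≤ p ^ (B * (R + (D + 1))))
    (h : IsExploration G H π c o v₀ F O C O' C' A l) :
    CondHitGE G π v₀ T p O' C' (condEnhProb H c o T F p s O C) := by
  classical
  induction hn : (F \ (O ∪ C)).card using Nat.strong_induction_on
    generalizing O C O' C' A l with
  | _ n ih =>
    -- The induction is on the number of unrevealed bits. If `T` has been reached, the cluster in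
    -- `G` hits with conditional probability one.
    by_cases hAT : ∃ w ∈ A, w ∈ T
    · obtain ⟨w, hwA, hwT⟩ := hAT
      refine (condHitGE_one ⟨l w, ?_, h.reachable w hwA⟩).mono (condEnhProb_le_one hp hs)
      rwa [h.lift w hwA]
    push Not at hAT
    have hcard₁ : ∀ i ∈ F \ (O ∪ C), (F \ (insert i O ∪ C)).card < n := fun i hi => by
      rw [← hn]
      refine Finset.card_lt_card ⟨fun j hj => ?_, fun hsub => ?_⟩
      · simp only [Finset.mem_sdiff, Finset.mem_union, Finset.mem_insert] at hj ⊢; tauto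
      · have := hsub hi; simp at this
    have hcard₀ : ∀ i ∈ F \ (O ∪ C), (F \ (O ∪ insert i C)).card < n := fun i hi => by
      rw [← hn]
      refine Finset.card_lt_card ⟨fun j hj => ?_, fun hsub => ?_⟩
      · simp only [Finset.mem_sdiff, Finset.mem_union, Finset.mem_insert] at hj ⊢; tauto
      · have := hsub hi; simp at this
    by_cases hedge : ∀ a ∈ A, ∀ b, H.Adj a b → Sum.inl s(a, b) ∈ F →
      Sum.inl s(a, b) ∈ O ∨ Sum.inl s(a, b) ∈ C
    swap
    · push Not at hedge
      obtain ⟨a, ha, b, hab, heF, heO, heC⟩ := hedge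
      have hi : Sum.inl s(a, b) ∈ F \ (O ∪ C) := by simp [heF, heO, heC]
      obtain ⟨y, hy, hyb⟩ := hπ.exists_lift (l a) b (by rwa [h.lift a ha])
      -- Examined edges of `G` project to a vertex or to a revealed edge of `H`, so an edge above an
      -- unrevealed one is fresh.
      have hfresh : ¬ (s(l a, y) ∈ O' ∨ s(l a, y) ∈ C') := by
        intro h'
        have := h.explored _ h'
        rw [Sym2.map_mk, h.lift a ha, hyb] at this
        rcases this with h' | h' | h'
        · exact hab.ne (by simpa using h')
        · exact heO h'
        · exact heC h'
      rw [not_or] at hfresh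
      rw [condEnhProb_split hi]
      exact CondHitGE.reveal hp hy hfresh.1 hfresh.2
        (ih _ (hcard₁ _ hi) (h.edge_open ha hyb hy heC) rfl)
        (ih _ (hcard₀ _ hi) (h.edge_closed ha hyb heF heO) rfl)
    by_cases hcentre : ∀ u, Sum.inr u ∈ F → (∀ w, c w = u → w ∈ A) →
      (∀ a b, H.Adj a b → c a = u → c b = u → Sum.inl s(a, b) ∈ O) →
      Sum.inr u ∈ O ∨ Sum.inr u ∈ C
    swap
    · push Not at hcentre
      obtain ⟨u, huF, hA, hin, huO, huC⟩ := hcentre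
      have hi : Sum.inr u ∈ F \ (O ∪ C) := by simp [huF, huO, huC]
      have hu : c u = u := ((hF.centre u).1 huF).1
      obtain ⟨Z, τ, hZG, hZcard, hZe, hZu, hZC, hτ⟩ := h.exists_fresh_edges hG hH hπ hlift hc htame
        hF hB hAT hedge hu huC hA hin
      have hmono := condEnhProb_insert_le (H := H) (c := c) (o := o) (T := T) (F := F) (O := O)
        (C := C) hp hs (Sum.inr u)
      have hactive := h.centre_active huC hA (h.reachable u (hA u hu)) hZe
        (E := {b | (∃ a, c a = u ∧ H.Adj a b) ∧ b ∉ A}) (τ := τ)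
        (fun x y hx hxy hy => ⟨⟨x, hx, hxy⟩, hy⟩) (fun b hb => hτ b hb.1 hb.2)
      refine (CondHitGE.reveal_finset hp Z hmono hZG hZC (ih _ (hcard₁ _ hi) hactive rfl)
        fun O'' h1 h2 z hz => ih _ (hcard₀ _ hi)
          (h.centre_inactive huF huO hA h1 h2 hZe hZu hz) rfl).mono ?_
      rw [condEnhProb_split hi]
      have hpow : s ≤ p ^ Z.card :=
        hsp.trans (pow_le_pow_of_le_one hp.1 hp.2 hZcard)
      change s * _ + (1 - s) * _ ≤ _
      -- All edges of `Z` are open with probability at least `s`, and success is worth at least as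
      -- much as failure.
      nlinarith [mul_nonneg (sub_nonneg.2 hpow) (sub_nonneg.2 hmono)]
    -- Nothing relevant is left to reveal: the enhanced cluster is contained in `A`, which misses
    -- `T`.
    · refine condHitGE_zero.mono (le_of_eq ?_)
      unfold condEnhProb
      refine (bernoulliExp_congr_right _ fun S hS => if_neg ?_).trans
        (bernoulliExp_const (enhParam W p s) (F \ (O ∪ C)) 0)
      rintro ⟨w, hwT, hw⟩
      refine hAT w (h.mem_of_enhReach (S := S) (fun i hi => ?_) hedge hcentre ?_) hwT
      · have := hS (Finset.mem_coe.1 hi)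
        simpa [not_or] using this
      · rwa [Finset.coe_union] at hw

/-- The cluster of `v₀` in `G` is at least as likely to meet `π ⁻¹' T` as the enhanced cluster of
`π v₀` in `H` is to meet `T`. -/
theorem enhProb_le_clusterHits (hG : G.Connected) (hH : H.Connected)
    (hπ : IsWeakCovering G H π) (hlift : HasDisjointTreeLifting G H π)
    (hc : IsCellMap H c R D)
    (htame : ∀ x, ∃ y, π x = π y ∧ 0 < G.dist x y ∧ G.dist x y ≤ R)
    (hF : IsVolume H c T F)
    (hB : ∀ u, {b | ∃ a, c a = u ∧ H.Adj a b}.encard ≤ B) {p : I}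
    (hs : s ∈ Set.Icc (0 : ℝ) 1) (hsp : s ≤ (p : ℝ) ^ (B * (R + (D + 1)))) (v₀ : V) :
    enhProb H c (π v₀) T F p s ≤ (bondPercolation G p).real {S | ClusterHits G π v₀ T S} := by
  classical
  have hinit : IsExploration G H π c (π v₀) v₀ F ∅ ∅ ∅ ∅ {π v₀} (fun _ => v₀) :=
    { off_subset := by simp
      disjoint := by simp
      base := by simp
      edge := by simp
      centre := by simp
      lift := by simp
      reachable := by simp
      explored := by simp
      closed := by simp }
  obtain ⟨E, hE, -, hle⟩ :=
    hinit.condHitGE (s := s) hG hH hπ hlift hc htame hF hB p.2 hs hsp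
  have e1 : condEnhProb H c (π v₀) T F p s ∅ ∅ = enhProb H c (π v₀) T F p s := by
    simp [condEnhProb, enhProb]
  rw [e1] at hle
  refine hle.trans ?_
  have e2 : bernoulliExp (fun _ => (p : ℝ)) E (fun Y =>
      if ClusterHits G π v₀ T ((∅ ∪ Y : Finset _) : Set (Sym2 V)) then (1 : ℝ) else 0) =
      (bondPercolation G p).real {S | ClusterHits G π v₀ T (S ∩ E)} := by
    rw [bondPercolation, setBernoulli_real_inter _ p hE]
    simp
  rw [e2]
  refine MeasureTheory.measureReal_mono (fun S hS => ?_) ?_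
  · exact ClusterHits.mono Set.inter_subset_left hS
  · exact (MeasureTheory.measure_lt_top (ProbabilityTheory.setBernoulli G.edgeSet p) _).ne

end Domination

/-! ### Graphs of bounded degree -/

section BoundedDegree

variable {W : Type*} {H : SimpleGraph W}

theorem exists_encard_ball_le (hH : H.Connected) (hdeg : BoundedDegree H) (k : ℕ) :
    ∃ N : ℕ, ∀ u, {w | H.dist u w ≤ k}.encard ≤ N := by
  classical
  obtain ⟨Δ, hΔ⟩ := hdeg
  induction k with
  | zero =>
    refine ⟨1, fun u => ?_⟩
    have : {w | H.dist u w ≤ 0} = {u} := by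
      ext w
      rw [Set.mem_ofPred_eq, Nat.le_zero, hH.dist_eq_zero_iff, Set.mem_singleton_iff, eq_comm]
    rw [this]
    simp
  | succ k ih =>
    obtain ⟨N, hN⟩ := ih
    refine ⟨N + N * Δ, fun u => ?_⟩
    have hfin : {w | H.dist u w ≤ k}.Finite := Set.finite_of_encard_le_coe (hN u)
    have hnfin : ∀ w, (H.neighborSet w).Finite := fun w => Set.finite_of_encard_le_coe (hΔ w)
    have hcard : hfin.toFinset.card ≤ N := by
      have := hN u
      rw [hfin.encard_eq_coe_toFinset_card] at this
      exact_mod_cast this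
    have hncard : ∀ w, (hnfin w).toFinset.card ≤ Δ := fun w => by
      have := hΔ w
      rw [(hnfin w).encard_eq_coe_toFinset_card] at this
      exact_mod_cast this
    set K := hfin.toFinset ∪ hfin.toFinset.biUnion fun w => (hnfin w).toFinset with hK
    have hsub : {w | H.dist u w ≤ k + 1} ⊆ (K : Set W) := by
      intro w hw
      rw [hK, Finset.coe_union]
      by_cases h : H.dist u w ≤ k
      · exact Or.inl (by simpa using h)
      · have h1 : H.dist w u = k + 1 := by
          rw [SimpleGraph.dist_comm]
          exact le_antisymm hw (by omega)
        obtain ⟨p, hp⟩ := hH.exists_walk_length_eq_dist w u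
        cases p with
        | nil => simp at h1
        | @cons _ v _ hadj p =>
          refine Or.inr ?_
          rw [Finset.coe_biUnion, Set.mem_iUnion₂]
          refine ⟨v, ?_, by simpa using hadj.symm⟩
          rw [SimpleGraph.Walk.length_cons] at hp
          have := SimpleGraph.dist_le p
          rw [SimpleGraph.dist_comm] at this
          simp only [Set.Finite.coe_toFinset, Set.mem_ofPred_eq]
          omega
    refine (Set.encard_le_encard hsub).trans ?_
    rw [Set.encard_coe_eq_coe_finsetCard]
    have : K.card ≤ N + N * Δ := (Finset.card_union_le _ _).trans (add_le_add hcard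
      ((Finset.card_biUnion_le_card_mul _ _ _ fun w _ => hncard w).trans
        (Nat.mul_le_mul_right _ hcard)))
    exact_mod_cast this

theorem finite_ball (hH : H.Connected) (hdeg : BoundedDegree H) (u : W) (k : ℕ) :
    {w | H.dist u w ≤ k}.Finite :=
  let ⟨_, hN⟩ := exists_encard_ball_le hH hdeg k
  Set.finite_of_encard_le_coe (hN u)

theorem countable_of_boundedDegree (hH : H.Connected) (hdeg : BoundedDegree H) : Countable W := by
  obtain ⟨u⟩ := hH.nonempty
  rw [← Set.countable_univ_iff]
  refine (Set.countable_iUnion fun k => (finite_ball hH hdeg u k).countable).mono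
    fun w _ => Set.mem_iUnion.2 ⟨H.dist u w, ?_⟩
  exact le_refl (H.dist u w)

variable {c : W → W} {R D : ℕ}

theorem IsCellMap.dist_le (hc : IsCellMap H c R D) (w : W) : H.dist (c w) w ≤ D :=
  let ⟨p, _, hp, _⟩ := hc.exists_path w
  (SimpleGraph.dist_le p).trans hp

theorem exists_encard_cell_neighbors_le (hH : H.Connected) (hdeg : BoundedDegree H)
    (hc : IsCellMap H c R D) :
    ∃ B : ℕ, ∀ u, {b | ∃ a, c a = u ∧ H.Adj a b}.encard ≤ B := by
  obtain ⟨N, hN⟩ := exists_encard_ball_le hH hdeg (D + 1)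
  refine ⟨N, fun u => (Set.encard_le_encard ?_).trans (hN u)⟩
  rintro b ⟨a, rfl, hab⟩
  have h1 := hc.dist_le a
  have h2 := hH.dist_triangle (u := c a) (v := a) (w := b)
  rw [SimpleGraph.dist_eq_one_iff_adj.2 hab] at h2
  change H.dist (c a) b ≤ D + 1
  omega

theorem exists_ncard_cellBits_le (hH : H.Connected) (hdeg : BoundedDegree H)
    (hc : IsCellMap H c R D) : ∃ M : ℕ, ∀ (F : Finset (Sym2 W ⊕ W)) (u : W),
      {i | i ∈ F ∧ i ∈ cellBits H c u}.ncard ≤ M := by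
  classical
  obtain ⟨N, hN⟩ := exists_encard_ball_le hH hdeg (D + 1)
  -- Pairs of vertices in the ball of radius `D + 1`, plus the activity.
  refine ⟨N * N + 1, fun F u => ?_⟩
  have hfin : {w | H.dist u w ≤ D + 1}.Finite := Set.finite_of_encard_le_coe (hN u)
  have hcard : hfin.toFinset.card ≤ N := by
    have := hN u
    rw [hfin.encard_eq_coe_toFinset_card] at this
    exact_mod_cast this
  set K : Finset (Sym2 W ⊕ W) := insert (Sum.inr u)
    ((hfin.toFinset ×ˢ hfin.toFinset).image fun x => Sum.inl s(x.1, x.2)) with hK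
  have hsub : {i | i ∈ F ∧ i ∈ cellBits H c u} ⊆ (K : Set (Sym2 W ⊕ W)) := by
    rintro i ⟨-, rfl | ⟨x, y, hxy, rfl, rfl⟩⟩
    · simp [hK]
    · have h1 := hc.dist_le x
      have h2 := hH.dist_triangle (u := c x) (v := x) (w := y)
      rw [SimpleGraph.dist_eq_one_iff_adj.2 hxy] at h2
      rw [hK, Finset.mem_coe, Finset.mem_insert, Finset.mem_image]
      refine Or.inr ⟨(x, y), ?_, rfl⟩
      simp only [Finset.mem_product, Set.Finite.mem_toFinset, Set.mem_ofPred_eq]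
      omega
  refine (Set.ncard_le_ncard hsub K.finite_toSet).trans ?_
  rw [Set.ncard_coe_finset]
  refine (Finset.card_insert_le _ _).trans (Nat.add_le_add_right (Finset.card_image_le.trans ?_) 1)
  rw [Finset.card_product]
  exact Nat.mul_le_mul hcard hcard

/-- There are arbitrarily large finite volumes. -/
theorem exists_isVolume (hH : H.Connected) (hdeg : BoundedDegree H) (hc : IsCellMap H c R D)
    (o : W) (n : ℕ) :
    ∃ (T : Set W) (F : Finset (Sym2 W ⊕ W)), IsVolume H c T F ∧ Tᶜ.Finite ∧
      ∀ w ∈ T, n < H.dist o w := by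
  -- `T` consists of the cells lying entirely beyond distance `n`, so it is a union of cells; its
  -- complement lies in a ball of radius `n + 2D`.
  set T : Set W := {w | ∀ v, c v = c w → n < H.dist o v} with hT
  have hTfin : Tᶜ.Finite := by
    refine (finite_ball hH hdeg o (n + D + D)).subset fun w hw => ?_
    rw [hT, Set.mem_compl_iff, Set.mem_ofPred_eq] at hw
    push Not at hw
    obtain ⟨v, hv, hn⟩ := hw
    have h1 := hc.dist_le w
    have h2 := hc.dist_le v
    rw [SimpleGraph.dist_comm, hv] at h2
    have h3 := hH.dist_triangle (u := o) (v := v) (w := c w)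
    have h4 := hH.dist_triangle (u := o) (v := c w) (w := w)
    change H.dist o w ≤ n + D + D
    omega
  have hFfin : ({i | (∃ x y, H.Adj x y ∧ x ∉ T ∧ i = Sum.inl s(x, y)) ∨
      ∃ u, c u = u ∧ u ∉ T ∧ i = Sum.inr u} : Set (Sym2 W ⊕ W)).Finite := by
    obtain ⟨Δ, hΔ⟩ := hdeg
    have hnfin : ∀ w, (H.neighborSet w).Finite := fun w => Set.finite_of_encard_le_coe (hΔ w)
    refine ((hTfin.biUnion fun x _ => (hnfin x).image fun y => Sum.inl s(x, y)).union
      (hTfin.image Sum.inr)).subset ?_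
    rintro i (⟨x, y, hxy, hx, rfl⟩ | ⟨u, -, hu, rfl⟩)
    · exact Or.inl (Set.mem_biUnion (Set.mem_compl hx) ⟨y, hxy, rfl⟩)
    · exact Or.inr ⟨u, hu, rfl⟩
  refine ⟨T, hFfin.toFinset, ⟨fun w => ?_, fun e => ?_, fun u => ?_⟩, hTfin,
    fun w hw => hw w rfl⟩
  · simp only [hT, Set.mem_ofPred_eq, hc.idem]
  · simp
  · simp

end BoundedDegree

/-! ### The critical parameter -/

section Critical

open MeasureTheory ProbabilityTheory

variable {V W : Type*} {G : SimpleGraph V} {H : SimpleGraph W}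

instance (G : SimpleGraph V) (p : I) : IsProbabilityMeasure (bondPercolation G p) :=
  inferInstanceAs (IsProbabilityMeasure (setBernoulli G.edgeSet p))

/-- Reachability is a countable union, over the edge lists of walks, of finite intersections of
cylinder events. -/
theorem measurableSet_reachable [Countable V] (G : SimpleGraph V) (x y : V) :
    MeasurableSet {S : Set (Sym2 V) | (openSubgraph G S).Reachable x y} := by
  have : {S : Set (Sym2 V) | (openSubgraph G S).Reachable x y} =
      ⋃ L ∈ {L : List (Sym2 V) | ∃ p : G.Walk x y, p.edges = L}, ⋂ e ∈ {e | e ∈ L}, {S | e ∈ S} := by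
    ext S
    simp only [Set.mem_ofPred_eq, Set.mem_iUnion, Set.mem_iInter, exists_prop]
    constructor
    · rintro ⟨p⟩
      have hle : openSubgraph G S ≤ G := fun a b h => (openSubgraph_adj.1 h).2
      refine ⟨_, ⟨p.mapLe hle, rfl⟩, fun e he => ?_⟩
      rw [SimpleGraph.Walk.edges_mapLe_eq_edges] at he
      have := p.edges_subset_edgeSet he
      induction e with
      | _ a b => exact (openSubgraph_adj.1 this).1
    · rintro ⟨L, ⟨p, rfl⟩, h⟩
      exact reachable_map_of_walk id p fun a b hab =>
        openSubgraph_adj.2 ⟨h _ hab, p.adj_of_mem_edges hab⟩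
  rw [this]
  have : Countable (Sym2 V) := Quotient.countable
  exact MeasurableSet.biUnion (Set.to_countable _) fun L _ =>
    MeasurableSet.biInter (Set.to_countable _) fun e _ => measurableSet_mem_set e

/-- If the cluster of a vertex reaches any distance with probability bounded below, then infinite
clusters occur with positive probability. -/
theorem not_ae_of_reach (hG : G.Connected) (hdeg : BoundedDegree G) {p : I} {v₀ : V} {θ : ℝ}
    (hθ : 0 < θ) (h : ∀ n : ℕ, ∃ E : Set (Set (Sym2 V)), θ ≤ (bondPercolation G p).real E ∧
      ∀ S ∈ E, ∃ y ∈ cluster G S v₀, n ≤ G.dist v₀ y) :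
    ¬ ∀ᵐ S ∂(bondPercolation G p), ¬ HasInfiniteCluster G S := by
  have : Countable V := countable_of_boundedDegree hG hdeg
  set A : ℕ → Set (Set (Sym2 V)) := fun n => {S | ∃ y ∈ cluster G S v₀, n ≤ G.dist v₀ y} with hA
  have hmeas : ∀ n, MeasurableSet (A n) := fun n => by
    have : A n = ⋃ y ∈ {y | n ≤ G.dist v₀ y}, {S | (openSubgraph G S).Reachable v₀ y} := by
      ext S
      simp only [hA, cluster, Set.mem_ofPred_eq, Set.mem_iUnion, exists_prop]
      exact exists_congr fun y => and_comm
    rw [this]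
    exact MeasurableSet.biUnion (Set.to_countable _) fun y _ => measurableSet_reachable G v₀ y
  have hanti : Antitone A := fun m n hmn S ⟨y, hy, hn⟩ => ⟨y, hy, hmn.trans hn⟩
  have hge : ∀ n, ENNReal.ofReal θ ≤ bondPercolation G p (A n) := fun n => by
    obtain ⟨E, hE, hEA⟩ := h n
    rw [ENNReal.ofReal_le_iff_le_toReal (measure_ne_top _ _)]
    exact hE.trans (measureReal_mono fun S hS => hEA S hS)
  -- Continuity from above along the measurable events `A n`; the given events `E` need not be
  -- measurable.
  have hlim := tendsto_measure_iInter_atTop (μ := bondPercolation G p)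
    (fun n => (hmeas n).nullMeasurableSet) hanti ⟨0, measure_ne_top _ _⟩
  have hpos : ENNReal.ofReal θ ≤ bondPercolation G p (⋂ n, A n) :=
    ge_of_tendsto' hlim hge
  intro hae
  have hsub : (⋂ n, A n) ⊆ {S | ¬ ¬ HasInfiniteCluster G S} := by
    intro S hS
    refine not_not.2 ⟨v₀, fun hfin => ?_⟩
    obtain ⟨N, hN⟩ := (hfin.image fun y => G.dist v₀ y).bddAbove
    obtain ⟨y, hy, hy'⟩ := Set.mem_iInter.1 hS (N + 1)
    have := hN ⟨y, hy, rfl⟩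
    simp only at this
    omega
  have h0 : bondPercolation G p (⋂ n, A n) = 0 := measure_mono_null hsub hae
  rw [h0] at hpos
  exact absurd hpos (by simpa using hθ)

/-- Infinite clusters occur with positive probability only if some cluster is infinite with positive
probability. -/
theorem exists_infinite_cluster_pos [Countable V] {p : I}
    (h : ¬ ∀ᵐ S ∂(bondPercolation G p), ¬ HasInfiniteCluster G S) :
    ∃ x, 0 < (bondPercolation G p).real {S | (cluster G S x).Infinite} := by
  by_contra! hcon
  refine h ?_
  have : ∀ᵐ S ∂(bondPercolation G p), ∀ x, ¬ (cluster G S x).Infinite := by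
    rw [ae_all_iff]
    intro x
    have h0 := le_antisymm (hcon x) measureReal_nonneg
    rw [measureReal_eq_zero_iff] at h0
    rw [ae_iff]
    simpa using h0
  filter_upwards [this] with S hS
  rintro ⟨x, hx⟩
  exact hS x hx

/-- Prepares a union bound over edge sets of walks. For a self-avoiding path the edge set has
exactly `n` elements, hence is open with probability `p ^ n`. -/
theorem exists_path_edges_finset {Δ : ℕ} (hΔ : ∀ x, (H.neighborSet x).encard ≤ Δ) (n : ℕ) (x : W) :
    ∃ P : Finset (Finset (Sym2 W)), P.card ≤ Δ ^ n ∧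
      ∀ (y : W) (q : H.Walk x y), q.length = n → ∃ E ∈ P, ∀ e, e ∈ E ↔ e ∈ q.edges := by
  classical
  have hnfin : ∀ w, (H.neighborSet w).Finite := fun w => Set.finite_of_encard_le_coe (hΔ w)
  have hncard : ∀ w, (hnfin w).toFinset.card ≤ Δ := fun w => by
    have := hΔ w
    rw [(hnfin w).encard_eq_coe_toFinset_card] at this
    exact_mod_cast this
  induction n generalizing x with
  | zero =>
    refine ⟨{∅}, by simp, fun y q hq => ⟨∅, by simp, ?_⟩⟩
    cases q with
    | nil => simp
    | cons => simp at hq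
  | succ n ih =>
    choose P hP hPq using ih
    refine ⟨(hnfin x).toFinset.biUnion fun z => (P z).image (insert s(x, z)), ?_, ?_⟩
    · refine (Finset.card_biUnion_le_card_mul _ _ (Δ ^ n) fun z _ =>
        Finset.card_image_le.trans (hP z)).trans ?_
      rw [pow_succ']
      exact Nat.mul_le_mul_right _ (hncard x)
    · intro y q hq
      cases q with
      | nil => simp at hq
      | @cons _ z _ hadj q =>
        obtain ⟨E, hE, hEq⟩ := hPq z y q (by simpa using hq)
        refine ⟨insert s(x, z) E, ?_, fun e => ?_⟩
        · rw [Finset.mem_biUnion]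
          exact ⟨z, by simpa using hadj, Finset.mem_image_of_mem _ hE⟩
        · simp [hEq]

/-- The probability that a given cluster is infinite decays with the number of steps of its
self-avoiding paths. -/
theorem real_infinite_cluster_le (hH : H.Connected) (hdeg : BoundedDegree H) {Δ : ℕ}
    (hΔ : ∀ x, (H.neighborSet x).encard ≤ Δ) (p : I) (x : W) (n : ℕ) :
    (bondPercolation H p).real {S | (cluster H S x).Infinite} ≤ (Δ * p : ℝ) ^ n := by
  classical
  obtain ⟨P, hPcard, hP⟩ := exists_path_edges_finset hΔ n x
  set Q := P.filter fun E : Finset (Sym2 W) => E.card = n ∧ (E : Set (Sym2 W)) ⊆ H.edgeSet with hQ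
  have hsub : {S | (cluster H S x).Infinite} ⊆ ⋃ E ∈ Q, {S | (E : Set (Sym2 W)) ⊆ S} := by
    intro S hS
    -- An infinite cluster leaves the finite ball of radius `n`, so it contains an open path of at
    -- least `n` steps, to be truncated at `n`.
    obtain ⟨y, hy, hyn⟩ : ∃ y ∈ cluster H S x, n < H.dist x y := by
      by_contra! hcon
      exact hS ((finite_ball hH hdeg x n).subset hcon)
    obtain ⟨q, hq⟩ := SimpleGraph.Reachable.exists_isPath hy
    have hle : openSubgraph H S ≤ H := fun a b h => (openSubgraph_adj.1 h).2
    have hlen : n ≤ q.length := by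
      have := SimpleGraph.dist_le (q.mapLe hle)
      rw [SimpleGraph.Walk.length_mapLe] at this
      omega
    have hq' : (q.take n).IsPath := hq.take n
    have hlen' : ((q.take n).mapLe hle).length = n := by
      rw [SimpleGraph.Walk.length_mapLe, SimpleGraph.Walk.take_length, min_eq_left hlen]
    obtain ⟨E, hE, hEq⟩ := hP _ ((q.take n).mapLe hle) hlen'
    have hedges : ∀ e ∈ E, e ∈ (openSubgraph H S).edgeSet := fun e he => by
      rw [hEq, SimpleGraph.Walk.edges_mapLe_eq_edges] at he
      exact (q.take n).edges_subset_edgeSet he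
    rw [Set.mem_iUnion₂]
    refine ⟨E, ?_, fun e he => ?_⟩
    · rw [hQ, Finset.mem_filter]
      refine ⟨hE, ?_, fun e he => SimpleGraph.edgeSet_mono hle (hedges e he)⟩
      have hE' : E = ((q.take n).mapLe hle).edges.toFinset := by ext e; simp [hEq]
      rw [hE', List.toFinset_card_of_nodup, SimpleGraph.Walk.length_edges, hlen']
      rw [SimpleGraph.Walk.edges_mapLe_eq_edges]
      exact hq'.isTrail.edges_nodup
    · have := hedges e he
      induction e with
      | _ a b => exact (openSubgraph_adj.1 this).1
  calc (bondPercolation H p).real {S | (cluster H S x).Infinite}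
      ≤ (bondPercolation H p).real (⋃ E ∈ Q, {S | (E : Set (Sym2 W)) ⊆ S}) :=
        measureReal_mono hsub (measure_ne_top _ _)
    _ ≤ ∑ E ∈ Q, (bondPercolation H p).real {S | (E : Set (Sym2 W)) ⊆ S} :=
        measureReal_biUnion_finset_le _ _
    _ = ∑ E ∈ Q, (p : ℝ) ^ n := by
        refine Finset.sum_congr rfl fun E hE => ?_
        obtain ⟨-, hn, hEH⟩ := Finset.mem_filter.1 hE
        rw [bondPercolation, setBernoulli_real_superset _ p hEH, hn]
    _ ≤ (Δ * p : ℝ) ^ n := by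
        rw [Finset.sum_const, nsmul_eq_mul, mul_pow]
        refine mul_le_mul_of_nonneg_right ?_ (pow_nonneg p.2.1 n)
        exact_mod_cast (Finset.card_filter_le _ _).trans hPcard

/-- For `p = 1 / (2 * (Δ + 1))` one has `Δ * p < 1`, and the path count makes every cluster almost
surely finite. -/
theorem criticalParameter_pos (hH : H.Connected) (hdeg : BoundedDegree H) :
    0 < criticalParameter H := by
  have : Countable W := countable_of_boundedDegree hH hdeg
  obtain ⟨Δ, hΔ⟩ := hdeg
  have hΔ0 : (0 : ℝ) < 2 * (Δ + 1) := by positivity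
  set p : I := ⟨1 / (2 * (Δ + 1)), by positivity, by
    rw [div_le_one hΔ0]; have : (0 : ℝ) ≤ Δ := Nat.cast_nonneg _; linarith⟩ with hp
  have hp0 : (0 : I) < p := by
    rw [← Subtype.coe_lt_coe]
    change (0 : ℝ) < 1 / (2 * (Δ + 1))
    positivity
  refine hp0.trans_le (le_sSup ?_)
  by_contra h
  obtain ⟨x, hx⟩ := exists_infinite_cluster_pos h
  have hle := real_infinite_cluster_le hH ⟨Δ, hΔ⟩ hΔ p x
  have hhalf : (Δ * p : ℝ) < 1 := by
    change (Δ : ℝ) * (1 / (2 * (Δ + 1))) < 1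
    rw [mul_one_div, div_lt_one hΔ0]
    have : (0 : ℝ) ≤ Δ := Nat.cast_nonneg _
    linarith
  have hlim := tendsto_pow_atTop_nhds_zero_of_lt_one
    (mul_nonneg (Nat.cast_nonneg Δ) p.2.1) hhalf
  exact absurd (ge_of_tendsto' hlim hle) (not_le.2 hx)

end Critical

/-! ### Choice of the parameters and conclusion. -/

section Main

open MeasureTheory ProbabilityTheory

variable {V W : Type*} {G : SimpleGraph V} {H : SimpleGraph W} {π : V → W} {c : W → W}
  {T : Set W} {F : Finset (Sym2 W ⊕ W)}

theorem bernoulliExp_map {ι κ : Type*} (q : κ → ℝ) (g : ι ↪ κ) (F : Finset ι)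
    (f : Finset κ → ℝ) :
    bernoulliExp q (F.map g) f = bernoulliExp (fun i => q (g i)) F (fun S => f (S.map g)) := by
  classical
  induction F using Finset.induction_on generalizing f with
  | empty => simp
  | insert i F hi ih =>
    rw [Finset.map_insert, bernoulliExp_insert _ _ (by simpa using hi), bernoulliExp_insert _ _ hi,
      ih, ih]
    simp only [Finset.map_insert]

theorem IsWeakCovering.surjective (hG : G.Connected) (hH : H.Connected)
    (hπ : IsWeakCovering G H π) : Function.Surjective π := by
  obtain ⟨v⟩ := hG.nonempty
  have key : ∀ {a b : W}, H.Walk a b → (∃ x, π x = a) → ∃ y, π y = b := by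
    intro a b p
    induction p with
    | nil => exact id
    | cons hadj p ih =>
      rintro ⟨x, rfl⟩
      obtain ⟨y, -, hy⟩ := hπ.exists_lift x _ hadj
      exact ih ⟨y, hy⟩
  intro w
  obtain ⟨p⟩ := hH.preconnected (π v) w
  exact key p ⟨v, rfl⟩

/-- An infinite cluster leaves every finite volume. -/
theorem enhHits_of_infinite_cluster (hF : IsVolume H c T F) (hT : Tᶜ.Finite) {o : W}
    {S : Set (Sym2 W)} (hS : (cluster H S o).Infinite) {X : Set (Sym2 W ⊕ W)}
    (hX : ∀ e ∈ S, Sum.inl e ∈ F → Sum.inl e ∈ X) : EnhHits H c o T X := by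
  obtain ⟨t, ht, htT⟩ : ∃ t ∈ cluster H S o, t ∈ T := by
    by_contra! hcon
    exact hS (hT.subset hcon)
  have key : ∀ {a b : W}, (openSubgraph H S).Walk a b → b ∈ T → EnhReach H c o X a →
      EnhHits H c o T X := by
    intro a b p
    induction p with
    | nil => exact fun hb h => ⟨_, hb, h⟩
    | @cons a a' b hadj p ih =>
      intro hb h
      by_cases haT : a ∈ T
      · exact ⟨a, haT, h⟩
      · rw [openSubgraph_adj] at hadj
        exact ih hb (.edge h hadj.2 (hX _ hadj.1 ((hF.edge _).2 ⟨a, a', hadj.2, haT, rfl⟩)))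
  obtain ⟨p⟩ := ht
  exact key p htT .base

/-- An infinite cluster reaches `T` through edges of `F`, and adding activities can only enlarge the
cluster. -/
theorem real_infinite_cluster_le_enhProb (hF : IsVolume H c T F) (hT : Tᶜ.Finite) (o : W) (p : I)
    {s : ℝ} (hs : s ∈ Set.Icc (0 : ℝ) 1) :
    (bondPercolation H p).real {S | (cluster H S o).Infinite} ≤ enhProb H c o T F p s := by
  classical
  have hFH : (F.toLeft : Set (Sym2 W)) ⊆ H.edgeSet := by
    intro e he
    rw [Finset.mem_coe, Finset.mem_toLeft, hF.edge] at he
    obtain ⟨x, y, hxy, -, rfl⟩ := he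
    exact hxy
  have h1 : (bondPercolation H p).real {S | (cluster H S o).Infinite} ≤
      (bondPercolation H p).real
        {S | EnhHits H c o T (Sum.inl '' (S ∩ (F.toLeft : Set (Sym2 W))))} := by
    refine measureReal_mono (fun S hS => ?_) (measure_ne_top _ _)
    exact enhHits_of_infinite_cluster hF hT hS fun e he heF =>
      ⟨e, ⟨he, Finset.mem_coe.2 (Finset.mem_toLeft.2 heF)⟩, rfl⟩
  refine h1.trans ?_
  rw [bondPercolation, setBernoulli_real_inter _ p hFH (fun S => EnhHits H c o T (Sum.inl '' S))]
  have h2 := bernoulliExp_map (enhParam W p s) Function.Embedding.inl F.toLeft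
    (fun S => if EnhHits H c o T (S : Set (Sym2 W ⊕ W)) then 1 else 0)
  have h3 : F.toLeft.map Function.Embedding.inl ⊆ F := by
    intro i hi
    obtain ⟨e, he, rfl⟩ := Finset.mem_map.1 hi
    exact Finset.mem_toLeft.1 he
  refine le_trans (le_of_eq ?_) (bernoulliExp_mono_finset (enhParam_mem_Icc p.2 hs)
    (monotone_indicator_enhHits H c o T) h3)
  rw [h2]
  refine bernoulliExp_congr_right _ fun S _ => ?_
  rw [Finset.coe_map]
  rfl

/-- Assuming percolation at every `q > a` makes monotonicity of percolation in the parameter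
unnecessary. -/
theorem criticalParameter_le_of_forall_lt {a : I}
    (h : ∀ q : I, a < q → ¬ ∀ᵐ S ∂(bondPercolation G q), ¬ HasInfiniteCluster G S) :
    criticalParameter G ≤ a :=
  sSup_le fun q hq => not_lt.1 fun hlt => h q hlt hq

theorem criticalParameter_lt_of_isWeakCovering (hG : G.Connected) (hH : H.Connected)
    (hGdeg : BoundedDegree G) (hHdeg : BoundedDegree H) (hπ : IsWeakCovering G H π)
    (htame : HasTameFibres G π) (hlift : HasDisjointTreeLifting G H π)
    (hpc : criticalParameter H < 1) : criticalParameter G < criticalParameter H := by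
  have : Countable W := countable_of_boundedDegree hH hHdeg
  obtain ⟨R, htame⟩ := htame
  obtain ⟨c, hc⟩ := exists_isCellMap hH R
  obtain ⟨B, hB⟩ := exists_encard_cell_neighbors_le hH hHdeg hc
  obtain ⟨M, hM⟩ := exists_ncard_cellBits_le hH hHdeg hc
  have hpc0 := criticalParameter_pos hH hHdeg
  set pc : ℝ := (criticalParameter H : ℝ) with hpcdef
  have hpc0' : 0 < pc := by exact_mod_cast hpc0
  have hpc1' : pc < 1 := by exact_mod_cast hpc
  set K := B * (R + (2 * R + 1)) with hK
  -- All parameters `q` used for `G` exceed `pc / 2`, so `σ₀` bounds the admissible activity density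
  -- `q ^ K` from below.
  set σ₀ : ℝ := (pc / 2) ^ K with hσ₀
  have hσ0 : 0 < σ₀ := by positivity
  have hσ1 : σ₀ ≤ 1 := pow_le_one₀ (by linarith) (by linarith)
  -- The edge density stays in `[pc / 2, (1 + pc) / 2]` and the activity density in `[σ₀ / 4, σ₀ /
  -- 2]`; both intervals lie in `[δ, 1 - δ]`.
  set δ : ℝ := min (min (pc / 2) ((1 - pc) / 2)) (σ₀ / 4) with hδdef
  have hδ1 : δ ≤ pc / 2 := (min_le_left _ _).trans (min_le_left _ _)
  have hδ2 : δ ≤ (1 - pc) / 2 := (min_le_left _ _).trans (min_le_right _ _)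
  have hδ3 : δ ≤ σ₀ / 4 := min_le_right _ _
  have hδ : 0 < δ := lt_min (lt_min (by linarith) (by linarith)) (by linarith)
  set C : ℝ := M * δ⁻¹ ^ M with hC
  have hC0 : 0 ≤ C := by positivity
  -- The first bound is the condition of the trade, with `C + 1` to avoid dividing by zero; the
  -- second keeps `η * t` below `pc / 2`.
  set η : ℝ := min (1 / (C + 1)) (pc / 2) with hη
  have hη0 : 0 < η := lt_min (by positivity) (by linarith)
  have hη1 : η * C ≤ 1 := by
    have h1 : η ≤ 1 / (C + 1) := min_le_left _ _
    have h2 : η * (C + 1) ≤ 1 := by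
      rwa [le_div_iff₀ (by positivity)] at h1
    nlinarith
  have hη2 : η ≤ pc / 2 := min_le_right _ _
  set t : ℝ := σ₀ / 4 with ht
  have ht0 : 0 < t := by positivity
  have htle : η * t ≤ pc / 2 := by nlinarith
  have hηt : 0 < η * t := mul_pos hη0 ht0
  -- a supercritical parameter close to the critical one
  set p' : ℝ := min (pc + η * t / 2) ((1 + pc) / 2) with hp'def
  have hp'1 : p' ≤ pc + η * t / 2 := min_le_left _ _
  have hp'2 : p' ≤ (1 + pc) / 2 := min_le_right _ _
  have hp'3 : pc < p' := lt_min (by linarith) (by linarith)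
  set P' : I := ⟨p', by linarith, by linarith⟩ with hP'
  obtain ⟨o, ho⟩ : ∃ o, 0 < (bondPercolation H P').real {S | (cluster H S o).Infinite} := by
    refine exists_infinite_cluster_pos fun hae => ?_
    have : P' ≤ criticalParameter H := le_sSup hae
    have : p' ≤ pc := by exact_mod_cast this
    linarith
  set θ := (bondPercolation H P').real {S | (cluster H S o).Infinite} with hθ
  obtain ⟨v₀, rfl⟩ := hπ.surjective hG hH o
  -- Since `p'` exceeds `pc` by at most half of `η * t`, the traded parameter falls strictly below
  -- `pc`.
  set a : I := ⟨p' - η * t, by linarith, by linarith⟩ with ha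
  have halt : a < criticalParameter H := by
    rw [← Subtype.coe_lt_coe]
    change p' - η * t < pc
    linarith
  refine lt_of_le_of_lt (criticalParameter_le_of_forall_lt fun q hq => ?_) halt
  have hq' : p' - η * t < (q : ℝ) := by exact_mod_cast hq
  refine not_ae_of_reach hG hGdeg (v₀ := v₀) ho fun n => ?_
  obtain ⟨T, F, hF, hTfin, hTn⟩ := exists_isVolume hH hHdeg hc (π v₀) n
  have hI : ∀ x : ℝ, 0 ≤ x → x ≤ 1 → x ∈ Set.Icc (0 : ℝ) 1 := fun x h0 h1 => ⟨h0, h1⟩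
  refine ⟨{S | ClusterHits G π v₀ T S}, ?_, ?_⟩
  -- The bound `θ` and the constants of the trade do not depend on `n`, so the cluster of `v₀`
  -- reaches every distance with probability at least `θ`.
  · calc θ ≤ enhProb H c (π v₀) T F p' t :=
          real_infinite_cluster_le_enhProb hF hTfin (π v₀) P' (hI t ht0.le (by linarith))
      _ ≤ enhProb H c (π v₀) T F (p' - η * t) (t + t) :=
          enhProb_le_of_trade hc hF (hM F) hδ hη0.le hη1 ht0.le (by linarith) (by linarith) hδ3
            (by linarith)
      _ ≤ enhProb H c (π v₀) T F q (t + t) :=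
          enhProb_mono a.2 (hI _ (by linarith) (by linarith)) q.2
            (hI _ (by linarith) (by linarith)) hq'.le le_rfl
      _ ≤ _ := by
          refine enhProb_le_clusterHits hG hH hπ hlift hc htame hF hB
            (hI _ (by linarith) (by linarith)) ?_ v₀
          have h1 : σ₀ ≤ (q : ℝ) ^ K :=
            pow_le_pow_left₀ (by linarith) (by linarith) K
          exact le_trans (by linarith) h1
  · rintro S ⟨y, hyT, hy⟩
    exact ⟨y, hy, (hTn _ hyT).le.trans (hπ.dist_le v₀ y)⟩

end Main

end PercolationCovering

open PercolationCovering
theorem theorem2p1 {V : Type*} {W : Type*} (G : SimpleGraph V) (H : SimpleGraph W)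
    (hG : G.Connected) (hH : H.Connected)
    (hGdeg : BoundedDegree G) (hHdeg : BoundedDegree H)
    (π : V → W) (hπ : IsWeakCovering G H π)
    (htame : HasTameFibres G π) (hlift : HasDisjointTreeLifting G H π)
    (hpc : criticalParameter G < 1) :
    criticalParameter G < criticalParameter H := by
  -- If `H` has critical parameter `1`, the claim is the hypothesis on `G`.
  rcases eq_or_lt_of_le (unitInterval.le_one' (t := criticalParameter H)) with h | h
  · rwa [h]
  · exact criticalParameter_lt_of_isWeakCovering hG hH hGdeg hHdeg hπ htame hlift h
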